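/- **Setting.** Let $H=(V,F)$ be a finite hypergraph: $V$ is a finite set and $F$ a set of non-empty subsets of $V$; $d_i=|\{\alpha\in F: i\in\alpha\}|$. An exponential family with base measure $\nu$ and sufficient statistic $\phi$ (with values in $\mathbb R^n$) consists of the densities $p_\theta=\exp(\langle\theta,\phi\rangle-\psi(\theta))$ with respect to $\nu$, $\psi(\theta)=\log\int e^{\langle\theta,\phi\rangle}d\nu$, $\theta\in\Theta=\mathrm{int}\{\theta:\psi(\theta)<\infty\}$; write $\Lambda(\theta)=E_{p_\theta}[\phi]$, $Y=\Lambda(\Theta)$, and $\varphi(\eta)=\sup_{\theta\in\Theta}(\langle\theta,\eta\rangle-\psi(\theta))$. An *inference family* on $H$ consists of non-zero $\sigma$-finite base measures $\nu_i$ on measurable spaces $\mathcal X_i$ and measurable statistics $\phi_i:\mathcal X_i\to\mathbb R^{r_i}$ ($i\in V$) and $\phi_{\langle\alpha\rangle}:\mathcal X_\alpha=\prod_{i\in\alpha}\mathcal X_i\to\mathbb R^{r_\alpha}$ ($\alpha\in F$). Let $\mathcal E_i$ be the exponential family given by $(\nu_i,\phi_i)$ and $\mathcal E_\alpha$ the one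 given by $\nu_\alpha=\prod_{i\in\alpha}\nu_i$ and $\phi_\alpha=(\phi_{\langle\alpha\rangle},(\phi_i)_{i\in\alpha})$; the corresponding objects carry the index $i$ or $\alpha$. It is required that the Hessians of all $\psi_i$, $\psi_\alpha$ are invertible on $\Theta_i$, $\Theta_\alpha$, and that for $i\in\alpha$ the marginal on $\mathcal X_i$ of every member of $\mathcal E_\alpha$ belongs to $\mathcal E_i$. Let $L$ be the set of all $\eta=(\{\eta_{\langle\alpha\rangle}\}_{\alpha\in F},\{\eta_i\}_{i\in V})$ such that $\eta_i\in Y_i$ for all $i$ and $\eta_\alpha:=(\eta_{\langle\alpha\rangle},(\eta_i)_{i\in\alpha})\in Y_\alpha$ for all $\alpha$. For $\eta\in L$ let $b_i\in\mathcal E_i$ and $b_\alpha\in\mathcal E_\alpha$ be the members with expectation parameters $\eta_i$ and $\eta_\alpha$. For given vectors $\bar\theta_\alpha$ (compatibility functions $\Psi_\alpha=e^{\langle\bar\theta_\alpha,\phi_\alpha\rangle}$) the Bethe free energy is $$F(\eta)=-\sum_{\alpha\in F}\langle\bar\theta_\alpha,\eta_\alpha\rangle+\sum_{\alpha\in F}\varphi_\alpha(\eta_\alpha)+\sum_{i\in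 V}(1-d_i)\varphi_i(\eta_i).$$ **Zeta function.** Let $\vec E$ be the set of directed edges $e=(\alpha\to i)$, $i\in\alpha\in F$, with $s(e)=\alpha$, $t(e)=i$. Write $e'\rightharpoonup e$ if $t(e')\in s(e)$, $t(e')\ne t(e)$ and $s(e')\neq s(e)$. A closed geodesic is a sequence $(e_1,\dots,e_k)$, $k\ge1$, with $e_l\rightharpoonup e_{l+1}$ for all $l\in\mathbb Z/k\mathbb Z$; it is prime if it is not an $m$-fold repetition ($m\ge2$) of a closed geodesic; a prime cycle is a prime closed geodesic up to cyclic permutation. For complex matrix weights $u=\{u_{e'\rightharpoonup e}\}$, where $u_{e'\rightharpoonup e}$ is of size $r_{t(e)}\times r_{t(e')}$, put $$\zeta_H(u)=\prod_{\mathfrak p}\det(I-\pi(\mathfrak p))^{-1},\qquad \pi(\mathfrak p)=u_{e_k\rightharpoonup e_1}\cdots u_{e_2\rightharpoonup e_3}u_{e_1\rightharpoonup e_2}\ \text{ for } \mathfrak p=(e_1,\dots,e_k),$$ the product being over all prime cycles and taken for sufficiently small $u$. Let $M(u)$ be the operator $(M(u)f)(e)=\sum_{e':e'\rightharpoonup e}u_{e'\rightharpoonup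 e}f(e')$ on the functions $f$ on $\vec E$ with $f(e)\in\mathbb C^{r_{t(e)}}$. **Theorem (Bethe-zeta formula).** For all sufficiently small weights $u$ the Euler product $\zeta_H(u)$ converges, and $\zeta_H^{-1}$ extends uniquely to a holomorphic function, again denoted $\zeta_H^{-1}$, on the whole space of matrix weights. At every $\eta\in L$ the function $F$ is twice continuously differentiable, and with the weights $$u_{e'\rightharpoonup e}:=u^{s(e)}_{t(e')\to t(e)},\qquad u^\alpha_{i\to j}:=\mathrm{Var}_{b_j}(\phi_j)^{-1}\,\mathrm{Cov}_{b_\alpha}(\phi_j,\phi_i),$$ one has $$\zeta_H(u)^{-1}=\det(I-M(u))=\det(\nabla^2F(\eta))\prod_{\alpha\in F}\det\mathrm{Var}_{b_\alpha}(\phi_\alpha)\prod_{i\in V}\big(\det\mathrm{Var}_{b_i}(\phi_i)\big)^{1-d_i},$$ where $\nabla^2F$ is the Hessian in the coordinates $(\{\eta_{\langle\alpha\rangle}\},\{\eta_i\})$. -/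

import Mathlib

open MeasureTheory ProbabilityTheory Topology Matrix
open scoped ENNReal

noncomputable section

/-! ### Hessians -/

/-- The Hessian matrix `(∂²f / ∂x_a ∂x_b)(x)` of a function of the coordinates `x : κ → ℝ`. -/
def hessian {κ : Type*} [Fintype κ] [DecidableEq κ] (f : (κ → ℝ) → ℝ) (x : κ → ℝ) :
    Matrix κ κ ℝ :=
  Matrix.of fun a b => fderiv ℝ (fderiv ℝ f) x (Pi.single a 1) (Pi.single b 1)

/-! ### FinHypergraphs, directed edges, closed geodesics and prime cycles -/

/-- A (finite) hypergraph: a finite set of non-empty subsets of `V`. -/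
structure FinHypergraph (V : Type*) where
  edges : Finset (Finset V)
  nonempty_of_mem : ∀ α ∈ edges, α.Nonempty

namespace FinHypergraph

variable {V : Type*}

/-- The hyperedges (factors) of `H`, as a type. -/
abbrev Factor (H : FinHypergraph V) : Type _ := {α : Finset V // α ∈ H.edges}

/-- The degree `d_i`, the number of hyperedges that contain `i`. -/
def degree [DecidableEq V] (H : FinHypergraph V) (i : V) : ℕ :=
  (H.edges.filter fun α => i ∈ α).card

/-- The directed edges `α → i`, one for each pair `i ∈ α`. -/
abbrev DirEdge (H : FinHypergraph V) : Type _ := Σ α : H.Factor, {i : V // i ∈ α.1}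

/-- The starting hyperedge of a directed edge. -/
abbrev src {H : FinHypergraph V} (e : H.DirEdge) : H.Factor := e.1

/-- The terminus vertex of a directed edge. -/
abbrev tgt {H : FinHypergraph V} (e : H.DirEdge) : V := e.2.1

/-- The relation `e' ⇀ e`: the terminus of `e'` lies in the starting hyperedge of `e`, it is
not the terminus of `e`, and the two starting hyperedges are distinct (no backtracking). -/
def Follows (H : FinHypergraph V) (e' e : H.DirEdge) : Prop :=
  tgt e' ∈ (src e).1 ∧ tgt e' ≠ tgt e ∧ src e' ≠ src e

instance [DecidableEq V] (H : FinHypergraph V) : DecidableRel H.Follows := fun e' e =>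
  inferInstanceAs (Decidable (tgt e' ∈ (src e).1 ∧ tgt e' ≠ tgt e ∧ src e' ≠ src e))

/-- `(e_1, …, e_k)`, `k ≥ 1`, is a closed geodesic if `e_l ⇀ e_{l+1}` for all `l` modulo `k`. -/
def IsClosedGeodesic (H : FinHypergraph V) (c : List H.DirEdge) : Prop :=
  c ≠ [] ∧ Cycle.Chain H.Follows (c : Cycle H.DirEdge)

/-- A closed geodesic is prime if it is not the `m`-fold repetition, `m ≥ 2`, of a closed
geodesic. -/
def IsPrimeGeodesic (H : FinHypergraph V) (c : List H.DirEdge) : Prop :=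
  H.IsClosedGeodesic c ∧
    ∀ (c' : List H.DirEdge) (m : ℕ), 2 ≤ m → H.IsClosedGeodesic c' →
      c ≠ (List.replicate m c').flatten

/-- Prime cycles: prime closed geodesics up to cyclic permutation. -/
def PrimeCycle (H : FinHypergraph V) : Type _ :=
  {c : Cycle H.DirEdge // ∃ l : List H.DirEdge, (l : Cycle H.DirEdge) = c ∧ H.IsPrimeGeodesic l}

/-! ### The graph zeta function with matrix weights -/

/-- The pairs `(e', e)` with `e' ⇀ e`. -/
abbrev FollowsPair (H : FinHypergraph V) : Type _ :=
  {p : H.DirEdge × H.DirEdge // H.Follows p.1 p.2}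

/-- Matrix weights: a complex `r_e × r_{e'}` matrix (given by its entries) for each pair
`e' ⇀ e`. -/
abbrev Weight (H : FinHypergraph V) (r : H.DirEdge → ℕ) : Type _ :=
  (p : H.FollowsPair) → Fin (r p.1.2) → Fin (r p.1.1) → ℂ

variable [DecidableEq V] {H : FinHypergraph V} {r : H.DirEdge → ℕ}

/-- The block at `(e, e')`: the weight `u_{e' ⇀ e}` if `e' ⇀ e`, and `0` otherwise. -/
def Weight.block (u : H.Weight r) (e e' : H.DirEdge) : Matrix (Fin (r e)) (Fin (r e')) ℂ :=
  if h : H.Follows e' e then Matrix.of (u ⟨(e', e), h⟩) else 0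

/-- The matrix of the operator `(M(u) f)(e) = ∑_{e' ⇀ e} u_{e' ⇀ e} f(e')`. -/
def Weight.edgeMatrix (u : H.Weight r) :
    Matrix (Σ e : H.DirEdge, Fin (r e)) (Σ e : H.DirEdge, Fin (r e)) ℂ :=
  Matrix.of fun a b => u.block a.1 b.1 a.2 b.2

/-- `u_{e_k ⇀ b} ⋯ u_{e_1 ⇀ e_2} u_{a ⇀ e_1}` for the list `(e_1, …, e_k)`. -/
def Weight.pathProd (u : H.Weight r) :
    (a : H.DirEdge) → List H.DirEdge → (b : H.DirEdge) → Matrix (Fin (r b)) (Fin (r a)) ℂ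
  | a, [], b => u.block b a
  | a, c :: l, b => u.pathProd c l b * u.block c a

/-- `det (I - π)` with `π = u_{e_k ⇀ e_1} ⋯ u_{e_2 ⇀ e_3} u_{e_1 ⇀ e_2}`, for `(e_1, …, e_k)`. -/
def Weight.geodesicDet (u : H.Weight r) : List H.DirEdge → ℂ
  | [] => 1
  | e :: l => (1 - u.pathProd e l e).det

/-- `det (I - π(𝔭))` for a prime cycle `𝔭`. It is computed from a representative of the
cyclic equivalence class; it does not depend on the choice, as `det (I - AB) = det (I - BA)`. -/
def Weight.cycleDet (u : H.Weight r) (p : H.PrimeCycle) : ℂ :=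
  u.geodesicDet (Quotient.out p.1)

/-- The Euler product `∏_𝔭 det (I - π(𝔭))⁻¹`, which is the graph zeta function wherever the
product converges. -/
def Weight.eulerProduct (u : H.Weight r) : ℂ := ∏' p : H.PrimeCycle, (u.cycleDet p)⁻¹

/-- `Z` is the reciprocal `u ↦ ζ_H(u)⁻¹` of the graph zeta function on the whole space of matrix
weights: it is holomorphic on that space, and for all sufficiently small weights the Euler
product converges (unconditionally) and `Z` is its reciprocal. -/
def IsReciprocalZeta (H : FinHypergraph V) (r : H.DirEdge → ℕ)
    (Z : H.Weight r → ℂ) : Prop :=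
  AnalyticOnNhd ℂ Z Set.univ ∧
    ∀ᶠ u in 𝓝 (0 : H.Weight r),
      Multipliable (fun p : H.PrimeCycle => (u.cycleDet p)⁻¹) ∧ Z u = (u.eulerProduct)⁻¹

/-- The matrix weights `u_{e' ⇀ e} := u^{s(e)}_{t(e') → t(e)}` induced by a family of `r_j × r_i`
matrices `u^α_{i → j}`, `i, j ∈ α`; here `r_e := r_{t(e)}`. -/
def weightOfFactors (H : FinHypergraph V) (r : V → ℕ)
    (u : (α : H.Factor) → (i j : {i : V // i ∈ α.1}) → Matrix (Fin (r j)) (Fin (r i)) ℂ) :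
    H.Weight (fun e => r (tgt e)) :=
  fun p a b => u (src p.1.2) ⟨tgt p.1.1, p.2.1⟩ p.1.2.2 a b

end FinHypergraph

/-! ### Exponential families -/

/-- The data of an exponential family: a base measure and a vector of sufficient statistics. -/
structure ExpFamily (X : Type*) [MeasurableSpace X] (ι : Type*) where
  base : Measure X
  stat : X → ι → ℝ

namespace ExpFamily

variable {X : Type*} [MeasurableSpace X] {ι : Type*} [Fintype ι] (E : ExpFamily X ι)

/-- `∫ exp ⟨θ, φ(x)⟩ dν(x)`, possibly infinite. -/
def partition (θ : ι → ℝ) : ℝ≥0∞ :=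
  ∫⁻ x, ENNReal.ofReal (Real.exp (θ ⬝ᵥ E.stat x)) ∂E.base

/-- The log partition function `ψ`. -/
def logPartition (θ : ι → ℝ) : ℝ := Real.log (E.partition θ).toReal

/-- The set `Θ` of natural parameters. -/
def paramSet : Set (ι → ℝ) := interior {θ | E.partition θ < ⊤}

/-- The density `p(x; θ) = exp (⟨θ, φ(x)⟩ - ψ(θ))`. -/
def density (θ : ι → ℝ) (x : X) : ℝ := Real.exp (θ ⬝ᵥ E.stat x - E.logPartition θ)

/-- The distribution with density `p(·; θ)` with respect to the base measure. -/
def law (θ : ι → ℝ) : Measure X :=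
  E.base.withDensity fun x => ENNReal.ofReal (E.density θ x)

/-- The map `Λ` from natural parameters to expectation parameters, `θ ↦ E_{p_θ}[φ]`. -/
def meanMap (θ : ι → ℝ) : ι → ℝ := fun k => ∫ x, E.stat x k ∂E.law θ

/-- The set `Y = Λ(Θ)` of expectation parameters. -/
def meanSet : Set (ι → ℝ) := E.meanMap '' E.paramSet

/-- The Legendre transform `φ(η) = sup_{θ ∈ Θ} (⟨θ, η⟩ - ψ(θ))`. -/
def legendre (η : ι → ℝ) : ℝ := ⨆ θ : E.paramSet, (θ.1 ⬝ᵥ η - E.logPartition θ.1)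

/-- The member of the family with expectation parameter `η`, that is `p_{Λ⁻¹(η)}`. -/
def belief (η : ι → ℝ) : Measure X := E.law (Function.invFunOn E.meanMap E.paramSet η)

end ExpFamily

/-- The matrix `Cov_μ(f, g)` of covariances of the components of `f` and `g`. -/
def covMatrix {X : Type*} [MeasurableSpace X] {κ l : Type*} (μ : Measure X)
    (f : X → κ → ℝ) (g : X → l → ℝ) : Matrix κ l ℝ :=
  Matrix.of fun a b => cov[fun x => f x a, fun x => g x b; μ]

/-- The matrix `Var_μ(f) = Cov_μ(f, f)`. -/
def varMatrix {X : Type*} [MeasurableSpace X] {κ : Type*} (μ : Measure X)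
    (f : X → κ → ℝ) : Matrix κ κ ℝ := covMatrix μ f f

/-! ### Inference families -/

/-- The data of the exponential families on a hypergraph: base measures `ν_i` and sufficient
statistics `φ_i` at the vertices and additional sufficient statistics `φ_⟨α⟩` at the factors. -/
structure StatisticData {V : Type*} (H : FinHypergraph V) (X : V → Type*)
    [∀ i, MeasurableSpace (X i)] where
  dimV : V → ℕ
  base : (i : V) → Measure (X i)
  statV : (i : V) → X i → Fin (dimV i) → ℝ
  dimF : H.Factor → ℕ
  statF : (α : H.Factor) → ((i : {i : V // i ∈ α.1}) → X i) → Fin (dimF α) → ℝ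

namespace StatisticData

variable {V : Type*} {H : FinHypergraph V} {X : V → Type*} [∀ i, MeasurableSpace (X i)]
variable (S : StatisticData H X)

/-- The exponential family `E_i` on `X_i`. -/
def vertexFamily (i : V) : ExpFamily (X i) (Fin (S.dimV i)) where
  base := S.base i
  stat := S.statV i

/-- The components of `φ_α = (φ_⟨α⟩, (φ_i)_{i ∈ α})`. -/
abbrev FactorIdx (α : H.Factor) : Type _ :=
  Fin (S.dimF α) ⊕ (Σ i : {i : V // i ∈ α.1}, Fin (S.dimV i))

/-- The exponential family `E_α` on `X_α = ∏_{i ∈ α} X_i`, with base measure `∏_{i ∈ α} ν_i` and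
sufficient statistic `φ_α = (φ_⟨α⟩, (φ_i)_{i ∈ α})`. -/
def factorFamily (α : H.Factor) :
    ExpFamily ((i : {i : V // i ∈ α.1}) → X i) (S.FactorIdx α) where
  base := Measure.pi fun i => S.base i
  stat := fun x => Sum.elim (S.statF α x) fun k => S.statV k.1 (x k.1) k.2

end StatisticData

/-- An inference family: the Hessians of all the log partition functions are invertible on the
parameter sets, and the vertex marginals of the members of `E_α` belong to `E_i`, `i ∈ α`. -/
structure InferenceFamily {V : Type*} [DecidableEq V] (H : FinHypergraph V) (X : V → Type*)
    [∀ i, MeasurableSpace (X i)] extends StatisticData H X where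
  sigmaFinite_base : ∀ i, SigmaFinite (base i)
  base_ne_zero : ∀ i, base i ≠ 0
  measurable_statV : ∀ i, Measurable (statV i)
  measurable_statF : ∀ α, Measurable (statF α)
  hessian_vertex_invertible : ∀ i, ∀ θ ∈ (toStatisticData.vertexFamily i).paramSet,
    IsUnit (hessian (toStatisticData.vertexFamily i).logPartition θ)
  hessian_factor_invertible : ∀ α, ∀ θ ∈ (toStatisticData.factorFamily α).paramSet,
    IsUnit (hessian (toStatisticData.factorFamily α).logPartition θ)
  marginally_closed : ∀ (α : H.Factor) (i : {i : V // i ∈ α.1}),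
    ∀ θ ∈ (toStatisticData.factorFamily α).paramSet,
      ∃ θ' ∈ (toStatisticData.vertexFamily i).paramSet,
        ((toStatisticData.factorFamily α).law θ).map (fun x => x i) =
          (toStatisticData.vertexFamily i).law θ'

namespace InferenceFamily

variable {V : Type*} [DecidableEq V] {H : FinHypergraph V} {X : V → Type*}
  [∀ i, MeasurableSpace (X i)] (I : InferenceFamily H X)

/-- The index set of the coordinates `({η_⟨α⟩}_α, {η_i}_i)`. -/
abbrev Coord : Type _ := (Σ α : H.Factor, Fin (I.dimF α)) ⊕ (Σ i : V, Fin (I.dimV i))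

/-- The component `η_i`. -/
def vertexPart (η : I.Coord → ℝ) (i : V) : Fin (I.dimV i) → ℝ := fun k => η (.inr ⟨i, k⟩)

/-- The component `η_α = (η_⟨α⟩, (η_i)_{i ∈ α})`, by local consistency `η_{α:i} = η_i`. -/
def factorPart (η : I.Coord → ℝ) (α : H.Factor) : I.FactorIdx α → ℝ :=
  Sum.elim (fun k => η (.inl ⟨α, k⟩)) fun k => η (.inr ⟨k.1, k.2⟩)

/-- The local-consistency set `L`, in the coordinates `({η_⟨α⟩}_α, {η_i}_i)`. -/
def localSet : Set (I.Coord → ℝ) :=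
  {η | (∀ α, I.factorPart η α ∈ (I.factorFamily α).meanSet) ∧
    ∀ i, I.vertexPart η i ∈ (I.vertexFamily i).meanSet}

/-- The Bethe free energy for the compatibility functions `Ψ_α = exp ⟨θbar_α, φ_α⟩`. -/
def betheFreeEnergy [Fintype V] (θbar : (α : H.Factor) → I.FactorIdx α → ℝ)
    (η : I.Coord → ℝ) : ℝ :=
  -(∑ α : H.Factor, θbar α ⬝ᵥ I.factorPart η α)
    + ∑ α : H.Factor, (I.factorFamily α).legendre (I.factorPart η α)
    + ∑ i : V, (1 - (H.degree i : ℝ)) * (I.vertexFamily i).legendre (I.vertexPart η i)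

/-- The belief `b_i` specified by `η`. -/
def vertexBelief (η : I.Coord → ℝ) (i : V) : Measure (X i) :=
  (I.vertexFamily i).belief (I.vertexPart η i)

/-- The belief `b_α` specified by `η`. -/
def factorBelief (η : I.Coord → ℝ) (α : H.Factor) :
    Measure ((i : {i : V // i ∈ α.1}) → X i) :=
  (I.factorFamily α).belief (I.factorPart η α)

/-- `Var_{b_i}(φ_i)`. -/
def vertexVar (η : I.Coord → ℝ) (i : V) : Matrix (Fin (I.dimV i)) (Fin (I.dimV i)) ℝ :=
  varMatrix (I.vertexBelief η i) (I.statV i)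

/-- `Var_{b_α}(φ_α)`. -/
def factorVar (η : I.Coord → ℝ) (α : H.Factor) : Matrix (I.FactorIdx α) (I.FactorIdx α) ℝ :=
  varMatrix (I.factorBelief η α) (I.factorFamily α).stat

/-- `u^α_{i → j} = Var_{b_j}(φ_j)⁻¹ Cov_{b_α}(φ_j, φ_i)`. -/
def factorWeight (η : I.Coord → ℝ) (α : H.Factor) (i j : {i : V // i ∈ α.1}) :
    Matrix (Fin (I.dimV j)) (Fin (I.dimV i)) ℝ :=
  (I.vertexVar η j)⁻¹ *
    covMatrix (I.factorBelief η α) (fun x => I.statV j (x j)) (fun x => I.statV i (x i))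

/-- The size `r_e := r_{t(e)}` of the matrix weights. -/
abbrev edgeDim (e : H.DirEdge) : ℕ := I.dimV (FinHypergraph.tgt e)

/-- The matrix weights `u_{e' ⇀ e} = u^{s(e)}_{t(e') → t(e)}` at `η`. -/
def weight (η : I.Coord → ℝ) : H.Weight I.edgeDim :=
  H.weightOfFactors I.dimV fun α i j => (I.factorWeight η α i j).map Complex.ofReal

end InferenceFamily

end

/-! The formula joins two independent identities, both with value `det (1 - M(u))`.

Zeta side. For small `u`, both `∏ det (1 - π(𝔭))⁻¹` and `det (1 - M)⁻¹` are exponentials of one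
absolutely convergent sum, that of `tr(c) / |c|` over all words `c` of directed edges. Grouped by
length it is `∑ tr (M ^ k) / k`. Only closed geodesics contribute, and each is in exactly one way a
rotation of a power of the chosen representative of a prime cycle
(`PrimeCycle.toGeodesic_injective`, `IsClosedGeodesic.mem_range_toGeodesic`), so grouped by prime
cycle it is `∑ tr (π(𝔭) ^ m) / m`. This is `hasProd_inv_cycleDet`. Since `det (1 - M(u))` is a
polynomial in `u`, the identity theorem makes it the only holomorphic extension.

Hessian side. By Legendre duality the Hessian of `φ_α` at `η_α` is `Var_{b_α}(φ_α)⁻¹`, and likewise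
at the vertices (`contDiffAt_legendre_and_hessian_eq`). Let `N` be the incidence matrix of directed
edges and their termini, `N'` its extension by an identity block for the additional statistics, `A`
the block diagonal matrix of the factor variances, and `D_U`, `D_W` those of the vertex variances
over vertices and over directed edges. The Hessian of `F` is `N'ᵀ A⁻¹ N'` plus `(1 - NᵀN) D_U⁻¹` in
the vertex block, because `NᵀN` is the diagonal of the degrees. Sylvester's identity `det (1 + XY) =
det (1 + YX)` transports the determinant to the directed edges (`det_transpose_mul_inv_mul_add`),
where it becomes that of `1 - (D_W⁻¹ A₂₂ - 1)(NNᵀ - 1)`, with `A₂₂` the block of `A` on the vertex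
statistics. That product is `M(u)` (`edgeMatrix_weight`): `NNᵀ - 1` changes the factor and keeps the
vertex, `D_W⁻¹ A₂₂ - 1` changes the vertex inside a factor. The diagonal blocks of the latter vanish
because the marginals of `b_α` are the `b_i`. -/

/-! ### Powers and rotations of words -/

section Words

variable {α : Type*}

/-- The `m`-fold repetition of a word. -/
abbrev List.repeated (x : List α) (m : ℕ) : List α := (List.replicate m x).flatten

theorem List.repeated_succ (x : List α) (m : ℕ) : x.repeated (m + 1) = x ++ x.repeated m := by
  simp [List.repeated, List.replicate_succ]

theorem List.repeated_add (x : List α) (m n : ℕ) :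
    x.repeated (m + n) = x.repeated m ++ x.repeated n := by
  rw [List.repeated, List.replicate_add, List.flatten_append]

theorem List.length_repeated (x : List α) (m : ℕ) : (x.repeated m).length = m * x.length := by
  simp [List.repeated]

theorem List.repeated_mul (x : List α) (m n : ℕ) :
    (x.repeated m).repeated n = x.repeated (m * n) := by
  induction n with
  | zero => simp [List.repeated]
  | succ n ih => rw [List.repeated_succ, ih, Nat.mul_succ, Nat.add_comm, List.repeated_add]

theorem List.append_repeated_comm (x : List α) (m : ℕ) :
    x ++ x.repeated m = x.repeated m ++ x := by
  rw [← List.repeated_succ, List.repeated_add]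
  simp [List.repeated]

theorem List.rotate_repeated_length (x : List α) (m : ℕ) :
    (x.repeated m).rotate x.length = x.repeated m := by
  cases m with
  | zero => simp [List.repeated]
  | succ m =>
    rw [List.repeated_succ, List.rotate_append_length_eq, List.append_repeated_comm]

theorem List.rotate_one_repeated (x : List α) (m : ℕ) :
    (x.repeated m).rotate 1 = (x.rotate 1).repeated m := by
  cases x with
  | nil => simp [List.repeated]
  | cons a l =>
    have key : ∀ m, l ++ ((a :: l).repeated m ++ [a]) = (l ++ [a]).repeated (m + 1) := by
      intro m
      induction m with
      | zero => simp [List.repeated]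
      | succ m ih =>
        rw [List.repeated_succ, List.repeated_succ, ← ih]
        simp
    cases m with
    | zero => simp [List.repeated]
    | succ m =>
      rw [List.repeated_succ]
      simp only [List.cons_append, List.rotate_cons_succ, List.rotate_zero]
      rw [← key m]; simp

theorem List.rotate_repeated (x : List α) (m n : ℕ) :
    (x.repeated m).rotate n = (x.rotate n).repeated m := by
  induction n with
  | zero => simp
  | succ n ih =>
    rw [← List.rotate_rotate, ih, List.rotate_one_repeated, List.rotate_rotate]

/-- Commutation makes `y` a prefix of `w`. Cancelling it leaves a shorter word that still commutes
with `y`, and the length hypothesis makes the process end at the empty word. -/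
theorem List.eq_repeated_of_append_comm {y w : List α} {k : ℕ} (hc : y ++ w = w ++ y)
    (hl : w.length = k * y.length) : w = y.repeated k := by
  induction k generalizing w with
  | zero => simpa [List.repeated] using hl
  | succ k ih =>
    have hle : y.length ≤ w.length := by rw [hl]; nlinarith
    have hp : y <+: w := by
      refine List.prefix_of_prefix_length_le (l₃ := w ++ y) ?_ (List.prefix_append _ _) hle
      rw [← hc]; exact List.prefix_append _ _
    obtain ⟨w', rfl⟩ := hp
    rw [List.repeated_succ, ← ih (w := w')]
    · simpa using hc
    · simp [Nat.succ_mul] at hl; omega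

/-- A word fixed by a rotation by a divisor of its length is a repetition. -/
theorem List.eq_repeated_of_rotate_eq {c : List α} {g : ℕ} (hg : g ∣ c.length)
    (hr : c.rotate g = c) : c = (c.take g).repeated (c.length / g) := by
  rcases Nat.eq_zero_or_pos c.length with h0 | hpos
  · rw [List.length_eq_zero_iff] at h0; subst h0; simp [List.repeated]
  have hle := Nat.le_of_dvd hpos hg
  have hgpos := Nat.pos_of_dvd_of_pos hg hpos
  refine List.eq_repeated_of_append_comm ?_ ?_
  -- A fixed rotation means that the two pieces of `c` can be swapped, hence that the first piece
  -- commutes with `c`.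
  · have h1 : c = c.drop g ++ c.take g := by
      rw [← List.rotate_eq_drop_append_take hle, hr]
    calc c.take g ++ c = c.take g ++ (c.drop g ++ c.take g) := by rw [← h1]
      _ = c ++ c.take g := by rw [← List.append_assoc, List.take_append_drop]
  · rw [List.length_take, min_eq_left hle, Nat.div_mul_cancel hg]

/-- Rotation by `n` is the `n`-th iterate of rotation by one, and the periods of a point under a map
are closed under gcd. -/
theorem List.rotate_gcd_eq {c : List α} {m n : ℕ} (hm : c.rotate m = c) (hn : c.rotate n = c) :
    c.rotate (m.gcd n) = c := by
  have key : ∀ (k : ℕ) (c : List α), (fun l : List α => l.rotate 1)^[k] c = c.rotate k := by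
    intro k
    induction k with
    | zero => simp
    | succ k ih => intro c; rw [Function.iterate_succ_apply', ih, List.rotate_rotate]
  have h1 : Function.IsPeriodicPt (fun l : List α => l.rotate 1) m c := by
    rw [Function.IsPeriodicPt, Function.IsFixedPt, key, hm]
  have h2 : Function.IsPeriodicPt (fun l : List α => l.rotate 1) n c := by
    rw [Function.IsPeriodicPt, Function.IsFixedPt, key, hn]
  have h3 := h1.gcd h2
  rwa [Function.IsPeriodicPt, Function.IsFixedPt, key] at h3

end Words

/-! ### Closed geodesics as powers of prime geodesics. -/

namespace FinHypergraph

variable {V : Type*} {H : FinHypergraph V}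

/-- The closed path of `x` is an initial segment of that of its repetition: after the first copy the
letter `a` returns, either at the start of the second copy or by closing up. -/
theorem IsClosedGeodesic.of_repeated {x : List H.DirEdge} {m : ℕ}
    (h : H.IsClosedGeodesic (x.repeated m)) : H.IsClosedGeodesic x := by
  obtain ⟨hne, hch⟩ := h
  cases x with
  | nil => simp [List.repeated] at hne
  | cons a l =>
    refine ⟨by simp, ?_⟩
    cases m with
    | zero => simp [List.repeated] at hne
    | succ m =>
      rw [List.repeated_succ] at hch
      rw [List.cons_append, Cycle.chain_coe_cons] at hch
      rw [Cycle.chain_coe_cons]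
      refine List.IsChain.prefix hch ?_
      cases m with
      | zero => simp [List.repeated]
      | succ m => rw [List.repeated_succ]; simp

theorem isClosedGeodesic_rotate {x : List H.DirEdge} (n : ℕ) :
    H.IsClosedGeodesic (x.rotate n) ↔ H.IsClosedGeodesic x := by
  have : ((x.rotate n : List H.DirEdge) : Cycle H.DirEdge) = x :=
    Cycle.coe_eq_coe.2 (List.IsRotated.forall x n)
  simp [IsClosedGeodesic, this]

theorem IsPrimeGeodesic.rotate {x : List H.DirEdge} (h : H.IsPrimeGeodesic x) (n : ℕ) :
    H.IsPrimeGeodesic (x.rotate n) := by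
  refine ⟨(isClosedGeodesic_rotate n).2 h.1, fun c' m hm hc' he => ?_⟩
  obtain ⟨k, hk⟩ := (List.IsRotated.forall x n)
  refine h.2 (c'.rotate k) m hm ((isClosedGeodesic_rotate k).2 hc') ?_
  rw [← hk, he]
  exact List.rotate_repeated c' m k

theorem IsPrimeGeodesic.length_pos {x : List H.DirEdge} (h : H.IsPrimeGeodesic x) :
    0 < x.length := List.length_pos_of_ne_nil h.1.1

/-- A prime geodesic that is a repetition of a word is that word. -/
theorem IsPrimeGeodesic.eq_of_eq_repeated {x z : List H.DirEdge} {k : ℕ}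
    (h : H.IsPrimeGeodesic x) (hx : x = z.repeated k) : k = 1 := by
  have hz : H.IsClosedGeodesic z := IsClosedGeodesic.of_repeated (m := k) (hx ▸ h.1)
  have hlt : ¬ 2 ≤ k := fun h2 => h.2 z k h2 hz hx
  have h0 : k ≠ 0 := by
    rintro rfl
    exact h.1.1 (by rw [hx]; simp [List.repeated])
  omega

/-- The gcd of `n` and the length is again a period, so `x` is a repetition of its prefix of that
length. Primeness forces the prefix to be all of `x`. -/
theorem IsPrimeGeodesic.eq_length_of_rotate_eq {x : List H.DirEdge} (h : H.IsPrimeGeodesic x)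
    {n : ℕ} (hn : x.rotate n = x) : x.length ∣ n := by
  have hr := List.rotate_gcd_eq hn (List.rotate_length x)
  have hd : n.gcd x.length ∣ x.length := Nat.gcd_dvd_right _ _
  have h1 := h.eq_of_eq_repeated (List.eq_repeated_of_rotate_eq hd hr)
  have : x.length = n.gcd x.length := by
    have := Nat.div_mul_cancel hd
    rw [h1] at this; omega
  rw [this]; exact Nat.gcd_dvd_left _ _

theorem IsPrimeGeodesic.rotate_injOn {x : List H.DirEdge} (h : H.IsPrimeGeodesic x)
    {i j : ℕ} (hi : i < x.length) (hj : j < x.length) (hij : x.rotate i = x.rotate j) :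
    i = j := by
  wlog hle : i ≤ j generalizing i j
  · exact (this hj hi hij.symm (by omega)).symm
  have h1 : x = x.rotate (j - i) := by
    apply List.rotate_injective i
    simp only
    rw [List.rotate_rotate, Nat.sub_add_cancel hle, hij]
  have := Nat.eq_zero_of_dvd_of_lt (h.eq_length_of_rotate_eq h1.symm) (by omega)
  omega

/-- Uniqueness of the primitive root. The common word is fixed by rotation by both lengths, hence by
their gcd `g`, so `x` and `y` are both repetitions of its prefix `z` of length `g`. Primeness makes
each equal to `z`. -/
theorem IsPrimeGeodesic.eq_of_repeated_eq {x y : List H.DirEdge} (hx : H.IsPrimeGeodesic x)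
    (hy : H.IsPrimeGeodesic y) {m n : ℕ} (he : x.repeated (m + 1) = y.repeated (n + 1)) :
    x = y ∧ m = n := by
  set c := x.repeated (m + 1) with hc
  set g := x.length.gcd y.length with hg
  have hr : c.rotate g = c := by
    refine List.rotate_gcd_eq (by rw [hc, List.rotate_repeated_length]) ?_
    rw [he, List.rotate_repeated_length]
  have hgx : g ∣ x.length := Nat.gcd_dvd_left _ _
  have hgy : g ∣ y.length := Nat.gcd_dvd_right _ _
  have hcx : c.length = (m + 1) * x.length := by rw [hc, List.length_repeated]
  have hcy : c.length = (n + 1) * y.length := by rw [he, List.length_repeated]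
  have hgc : g ∣ c.length := hcx ▸ Dvd.dvd.mul_left hgx _
  have hgpos : 0 < g := Nat.gcd_pos_of_pos_left _ hx.length_pos
  have hlz : (c.take g).length = g := by
    rw [List.length_take, min_eq_left]
    refine Nat.le_of_dvd ?_ hgc
    rw [hcx]; have := hx.length_pos; positivity
  have hcz := List.eq_repeated_of_rotate_eq hgc hr
  set z := c.take g with hz
  have key : ∀ (w : List H.DirEdge) (k : ℕ), H.IsPrimeGeodesic w → g ∣ w.length →
      c = w.repeated (k + 1) → w = z := by
    intro w k hw hgw hcw
    obtain ⟨q, hq⟩ := hgw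
    have hlen : c.length / g = q + k * q := by
      rw [hcw, List.length_repeated, hq]
      rw [show (k + 1) * (g * q) = g * (q + k * q) by ring, Nat.mul_div_cancel_left _ hgpos]
    have h1 : w ++ w.repeated k = z.repeated q ++ z.repeated (k * q) := by
      rw [← List.repeated_succ, ← hcw, ← List.repeated_add, ← hlen, ← hcz]
    have h2 := (List.append_inj h1 (by rw [List.length_repeated, hlz, hq, mul_comm])).1
    have h3 := hw.eq_of_eq_repeated h2
    rw [h2, h3]; simp [List.repeated]
  have hxy : x = y := (key x m hx hgx rfl).trans (key y n hy hgy he).symm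
  refine ⟨hxy, ?_⟩
  rw [hcx, hxy] at hcy
  have := Nat.eq_of_mul_eq_mul_right hy.length_pos hcy
  omega

theorem IsClosedGeodesic.exists_prime {c : List H.DirEdge} (h : H.IsClosedGeodesic c) :
    ∃ (x : List H.DirEdge) (m : ℕ), H.IsPrimeGeodesic x ∧ c = x.repeated (m + 1) := by
  induction hn : c.length using Nat.strong_induction_on generalizing c with
  | _ n ih =>
    by_cases hp : H.IsPrimeGeodesic c
    · exact ⟨c, 0, hp, by simp [List.repeated]⟩
    · simp only [IsPrimeGeodesic, h, true_and, not_forall, not_not] at hp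
      obtain ⟨c', m, hm, hc', he⟩ := hp
      have hl : c'.length < n := by
        have h1 : c.length = m * c'.length := by rw [he]; exact List.length_repeated _ _
        have h2 := List.length_pos_of_ne_nil hc'.1
        nlinarith
      obtain ⟨x, k, hx, hk⟩ := ih _ hl hc' rfl
      -- The exponent is `(k + 1) * m`, lowered by one because exponents are recorded as `m + 1`.
      refine ⟨x, k * m + m - 1, hx, ?_⟩
      rw [he, hk]
      have h2 : k * m + m - 1 + 1 = (k + 1) * m := by rw [Nat.succ_mul]; omega
      rw [h2]; exact List.repeated_mul _ _ _

/-- A prime geodesic that represents the given prime cycle. -/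
noncomputable def PrimeCycle.rep (p : H.PrimeCycle) : List H.DirEdge := Quotient.out p.1

theorem PrimeCycle.coe_rep (p : H.PrimeCycle) : (p.rep : Cycle H.DirEdge) = p.1 :=
  Quotient.out_eq p.1

theorem PrimeCycle.isPrimeGeodesic_rep (p : H.PrimeCycle) : H.IsPrimeGeodesic p.rep := by
  obtain ⟨l, hl, hp⟩ := p.2
  obtain ⟨n, hn⟩ := Cycle.coe_eq_coe.1 (hl.trans p.coe_rep.symm)
  rw [← hn]
  exact hp.rotate n

/-- All the closed geodesics, as rotated repetitions of the representatives of prime cycles. -/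
noncomputable def PrimeCycle.toGeodesic (t : Σ p : H.PrimeCycle, ℕ × Fin p.rep.length) :
    List H.DirEdge :=
  (t.1.rep.rotate t.2.2).repeated (t.2.1 + 1)

/-- The prime cycle, the exponent and the starting point are all recovered from the geodesic. A
prime cycle of length `n` has exactly `n` distinct rotations, which later turns the weight `1 / |c|`
into `1 / m`. -/
theorem PrimeCycle.toGeodesic_injective :
    Function.Injective (PrimeCycle.toGeodesic (H := H)) := by
  rintro ⟨p, m, i⟩ ⟨q, n, j⟩ h
  obtain ⟨h1, h2⟩ := (p.isPrimeGeodesic_rep.rotate i).eq_of_repeated_eq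
    (q.isPrimeGeodesic_rep.rotate j) h
  have hpq : p = q := by
    apply Subtype.ext
    rw [← p.coe_rep, ← q.coe_rep]
    refine Cycle.coe_eq_coe.2 ?_
    exact (List.IsRotated.forall p.rep i).symm.trans
      (by rw [h1]; exact List.IsRotated.forall q.rep j)
  subst hpq
  have hij := p.isPrimeGeodesic_rep.rotate_injOn i.2 j.2 h1
  simp only at h2
  rw [h2, Fin.ext hij]

theorem IsClosedGeodesic.mem_range_toGeodesic {c : List H.DirEdge} (h : H.IsClosedGeodesic c) :
    c ∈ Set.range (PrimeCycle.toGeodesic (H := H)) := by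
  obtain ⟨x, m, hx, rfl⟩ := h.exists_prime
  let p : H.PrimeCycle := ⟨x, x, rfl, hx⟩
  obtain ⟨n, hn⟩ := Cycle.coe_eq_coe.1 p.coe_rep
  refine ⟨⟨p, m, ⟨n % p.rep.length, Nat.mod_lt _ p.isPrimeGeodesic_rep.length_pos⟩⟩, ?_⟩
  simp only [PrimeCycle.toGeodesic, List.rotate_mod]
  rw [hn]

end FinHypergraph

/-! ### The logarithm of a determinant -/

namespace Matrix

variable {n : Type*} [Fintype n] [DecidableEq n]

open Polynomial in
/-- `det p(A) = ∏ p(λ)`, over the eigenvalues `λ` of `A`. -/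
theorem det_aeval_eq_prod_roots {K : Type*} [Field K] [IsAlgClosed K] (A : Matrix n n K)
    (p : K[X]) : (aeval A p).det = (A.charpoly.roots.map fun x => p.eval x).prod := by
  have hsp := IsAlgClosed.splits A.charpoly
  -- Both sides are multiplicative in `p`, and `p` splits, so it suffices to compare them on
  -- constants and on linear factors.
  let f : K[X] →* K := (detMonoidHom (n := n) (R := K)).comp (aeval A : K[X] →ₐ[K] _)
  let g : K[X] →* K :=
    { toFun := fun p => (A.charpoly.roots.map fun x => p.eval x).prod
      map_one' := by simp
      map_mul' := fun p q => by simp [Multiset.prod_map_mul] }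
  have hcard : A.charpoly.roots.card = Fintype.card n := by
    rw [← hsp.natDegree_eq_card_roots, A.charpoly_natDegree_eq_dim]
  have hX : ∀ a : K, f (X - C a) = g (X - C a) := by
    intro a
    have h1 : f (X - C a) = (A - scalar n a).det := by simp [f]; rfl
    have h2 : (A - scalar n a).det = (-1) ^ Fintype.card n * A.charpoly.eval a := by
      rw [eval_charpoly, ← det_neg, neg_sub]
    rw [h1, h2]
    conv_lhs => rw [hsp.eq_prod_roots_of_monic A.charpoly_monic]
    rw [eval_multiset_prod, ← hcard, Multiset.map_map]
    have : ∀ s : Multiset K, (-1) ^ s.card * (s.map (eval a ∘ fun x => X - C x)).prod =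
        (s.map fun x => (X - C a).eval x).prod := by
      intro s
      induction s using Multiset.induction with
      | empty => simp
      | cons x s ih => simp at ih ⊢; rw [← ih]; ring
    exact this _
  have hC : ∀ a : K, f (C a) = g (C a) := by
    intro a
    have : f (C a) = (algebraMap K (Matrix n n K) a).det := by simp [f]
    rw [this, algebraMap_eq_diagonal]
    simp [g, hcard]
  change f p = g p
  rw [(IsAlgClosed.splits p).eq_prod_roots, map_mul, map_mul, map_multiset_prod,
    map_multiset_prod, Multiset.map_map, Multiset.map_map, hC]
  congr 2
  exact Multiset.map_congr rfl fun a _ => hX a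

-- Applied to the polynomial `x - X ^ k`, the previous product formula factors the characteristic
-- polynomial of `A ^ k`, so its roots are the `k`-th powers of the eigenvalues, with multiplicity.
open Polynomial in
theorem trace_pow_eq_sum_roots {K : Type*} [Field K] [IsAlgClosed K] (A : Matrix n n K) (k : ℕ) :
    (A ^ k).trace = (A.charpoly.roots.map fun x => x ^ k).sum := by
  have : (A ^ k).charpoly = ((A.charpoly.roots.map fun x => x ^ k).map fun x => X - C x).prod := by
    apply Polynomial.funext
    intro x
    have h := det_aeval_eq_prod_roots A (C x - X ^ k)
    rw [eval_charpoly, eval_multiset_prod, Multiset.map_map, Multiset.map_map]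
    simp only [map_sub, aeval_C, map_pow, aeval_X, eval_sub, eval_C, eval_pow, eval_X] at h
    refine Eq.trans ?_ (h.trans ?_)
    · rw [algebraMap_eq_diagonal]; rfl
    · simp
  rw [trace_eq_sum_roots_charpoly, this, roots_multiset_prod_X_sub_C]

open scoped Matrix.Norms.Operator in
/-- `det (1 - A) = exp (-∑ tr (A ^ k) / k)`. -/
theorem exists_hasSum_trace_pow (A : Matrix n n ℂ) (hA : ‖A‖ < 1) :
    ∃ s : ℂ, HasSum (fun k : ℕ => (A ^ (k + 1)).trace / (k + 1)) s ∧
      (1 - A).det = Complex.exp (-s) := by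
  have hroot : ∀ x ∈ A.charpoly.roots, ‖x‖ < 1 := by
    intro x hx
    have hmem := mem_spectrum_of_isRoot_charpoly (Polynomial.isRoot_of_mem_roots hx)
    rcases isEmpty_or_nonempty n with h | h
    · simp [charpoly] at hx
    · exact (spectrum.norm_le_norm_of_mem hmem).trans_lt hA
  have hdet : (1 - A).det = (A.charpoly.roots.map fun x => 1 - x).prod := by
    have := det_aeval_eq_prod_roots A (1 - Polynomial.X)
    simpa using this
  simp only [trace_pow_eq_sum_roots, hdet]
  -- Only a multiset of numbers in the open unit disc remains, and the series of `-log (1 - x)` is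
  -- added up over it. Stating the result with `exp` avoids any branch of the logarithm of the
  -- determinant.
  generalize A.charpoly.roots = s at hroot
  induction s using Multiset.induction with
  | empty => exact ⟨0, by simp, by simp⟩
  | cons x s ih =>
    obtain ⟨t, ht, hd⟩ := ih fun y hy => hroot y (Multiset.mem_cons_of_mem hy)
    have hx := hroot x (Multiset.mem_cons_self x s)
    refine ⟨-Complex.log (1 - x) + t, ?_, ?_⟩
    · simp only [Multiset.map_cons, Multiset.sum_cons, add_div]
      exact (Complex.hasSum_taylorSeries_neg_log' hx).add ht
    · have h1 : (1 - x) ≠ 0 := by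
        rintro h0
        rw [sub_eq_zero] at h0
        rw [← h0] at hx; simp at hx
      rw [Multiset.map_cons, Multiset.prod_cons, hd, neg_add, neg_neg, Complex.exp_add,
        Complex.exp_log h1]

open scoped Matrix.Norms.Operator in
theorem norm_trace_le (A : Matrix n n ℂ) : ‖A.trace‖ ≤ Fintype.card n * ‖A‖ := by
  refine (norm_sum_le _ _).trans ?_
  rw [← nsmul_eq_mul, ← Finset.card_univ]
  refine Finset.sum_le_card_nsmul _ _ _ fun i _ => ?_
  have h1 : ‖A i i‖₊ ≤ ∑ j, ‖A i j‖₊ :=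
    Finset.single_le_sum (f := fun j => ‖A i j‖₊) (fun _ _ => zero_le) (Finset.mem_univ i)
  have h2 : ∑ j, ‖A i j‖₊ ≤ ‖A‖₊ := by
    rw [linfty_opNNNorm_def]
    exact Finset.le_sup (f := fun i => ∑ j, ‖A i j‖₊) (Finset.mem_univ i)
  exact_mod_cast h1.trans h2

open scoped Matrix.Norms.Operator in
theorem norm_le_card_mul_of_forall_norm_le {m l : Type*} [Fintype m] [Fintype l]
    {A : Matrix m l ℂ} {δ : ℝ}
    (hδ : 0 ≤ δ) (h : ∀ i j, ‖A i j‖ ≤ δ) : ‖A‖ ≤ Fintype.card l * δ := by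
  lift δ to NNReal using hδ
  have : ‖A‖₊ ≤ Fintype.card l * δ := by
    rw [linfty_opNNNorm_def]
    refine Finset.sup_le fun i _ => ?_
    rw [← nsmul_eq_mul, ← Finset.card_univ]
    exact Finset.sum_le_card_nsmul _ _ _ fun j _ => by exact_mod_cast h i j
  exact_mod_cast this

end Matrix

/-! ### The determinant formula for the zeta function -/

theorem sum_tuple_succ {E M : Type*} [Fintype E] [AddCommMonoid M] {k : ℕ}
    (f : (Fin (k + 1) → E) → M) :
    ∑ v, f v = ∑ c : E, ∑ w : Fin k → E, f (Fin.cons c w) := by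
  rw [← (Fin.consEquiv fun _ => E).sum_comp, Fintype.sum_prod_type]
  rfl

namespace FinHypergraph

variable {V : Type*} [DecidableEq V] {H : FinHypergraph V} {r : H.DirEdge → ℕ}

namespace Weight

variable (u : H.Weight r)

theorem pathProd_append (a c b : H.DirEdge) (l l' : List H.DirEdge) :
    u.pathProd a (l ++ c :: l') b = u.pathProd c l' b * u.pathProd a l c := by
  induction l generalizing a with
  | nil => rfl
  | cons d l ih =>
    simp only [List.cons_append, pathProd]
    rw [ih, Matrix.mul_assoc]

/-- The trace of the product of the weights along a closed word. -/
noncomputable def wordTrace : List H.DirEdge → ℂ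
  | [] => 0
  | e :: l => (u.pathProd e l e).trace

/-- Cyclicity of the trace: the product `π` depends on the starting edge, its trace does not. -/
theorem wordTrace_rotate_one (c : List H.DirEdge) : u.wordTrace (c.rotate 1) = u.wordTrace c := by
  cases c with
  | nil => simp
  | cons e l =>
    rw [List.rotate_cons_succ, List.rotate_zero]
    cases l with
    | nil => rfl
    | cons c l =>
      simp only [List.cons_append, wordTrace]
      rw [pathProd_append, Matrix.trace_mul_comm]
      rfl

theorem wordTrace_rotate (c : List H.DirEdge) (n : ℕ) :
    u.wordTrace (c.rotate n) = u.wordTrace c := by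
  induction n with
  | zero => simp
  | succ n ih => rw [← List.rotate_rotate, wordTrace_rotate_one, ih]

theorem pathProd_repeated (e : H.DirEdge) (l : List H.DirEdge) (m : ℕ) :
    u.pathProd e (l ++ (e :: l).repeated m) e = u.pathProd e l e ^ (m + 1) := by
  induction m with
  | zero => simp [List.repeated]
  | succ m ih =>
    rw [List.repeated_succ, List.cons_append, pathProd_append, ih, pow_succ _ (m + 1)]

theorem wordTrace_repeated (e : H.DirEdge) (l : List H.DirEdge) (m : ℕ) :
    u.wordTrace ((e :: l).repeated (m + 1)) = (u.pathProd e l e ^ (m + 1)).trace := by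
  rw [List.repeated_succ, List.cons_append, ← pathProd_repeated]
  rfl

theorem isChain_of_pathProd_ne_zero {a b : H.DirEdge} {l : List H.DirEdge}
    (h : u.pathProd a l b ≠ 0) : List.IsChain H.Follows (a :: (l ++ [b])) := by
  have hb : ∀ {e e' : H.DirEdge}, u.block e e' ≠ 0 → H.Follows e' e := by
    intro e e' h
    by_contra hf
    exact h (by simp [block, hf])
  induction l generalizing a with
  | nil => simpa using hb h
  | cons c l ih =>
    simp only [pathProd] at h
    have h1 := hb (e := c) (e' := a) fun h0 => h (by rw [h0, Matrix.mul_zero])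
    have h2 := ih (a := c) fun h0 => h (by rw [h0, Matrix.zero_mul])
    simpa using ⟨h1, h2⟩

/-- A word that breaks the relation `⇀` contains a zero block. Sums over closed geodesics may
therefore be replaced by sums over all words. -/
theorem isClosedGeodesic_of_wordTrace_ne_zero {c : List H.DirEdge} (h : u.wordTrace c ≠ 0) :
    H.IsClosedGeodesic c := by
  cases c with
  | nil => exact absurd rfl h
  | cons e l =>
    refine ⟨by simp, ?_⟩
    rw [Cycle.chain_coe_cons]
    refine u.isChain_of_pathProd_ne_zero fun h0 => h ?_
    rw [wordTrace, h0, Matrix.trace_zero]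

/-- Expansion of a matrix power over paths: `k` intermediate edges give `k + 1` blocks. -/
theorem sum_pathProd_eq_edgeMatrix_pow (k : ℕ) (a b : H.DirEdge) :
    ∑ v : Fin k → H.DirEdge, u.pathProd a (List.ofFn v) b =
      Matrix.of fun i j => (u.edgeMatrix ^ (k + 1)) ⟨b, i⟩ ⟨a, j⟩ := by
  induction k generalizing a with
  | zero => simp [pathProd]; rfl
  | succ k ih =>
    rw [sum_tuple_succ]
    simp only [List.ofFn_cons, pathProd]
    simp_rw [← Matrix.sum_mul, ih]
    ext i j
    rw [Matrix.sum_apply, Matrix.of_apply]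
    conv_rhs => rw [pow_succ, Matrix.mul_apply, Fintype.sum_sigma]
    rfl

theorem sum_wordTrace_eq_trace_pow (k : ℕ) :
    ∑ v : Fin (k + 1) → H.DirEdge, u.wordTrace (List.ofFn v) = (u.edgeMatrix ^ (k + 1)).trace := by
  rw [sum_tuple_succ]
  simp only [List.ofFn_cons, wordTrace]
  simp_rw [← Matrix.trace_sum, sum_pathProd_eq_edgeMatrix_pow]
  conv_rhs => rw [Matrix.trace, Fintype.sum_sigma]
  rfl

section Norm

open scoped Matrix.Norms.Operator

theorem norm_pathProd_le {δ : ℝ} (hδ : ∀ e e', ‖u.block e e'‖ ≤ δ) (a b : H.DirEdge)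
    (l : List H.DirEdge) : ‖u.pathProd a l b‖ ≤ δ ^ (l.length + 1) := by
  have h0 : 0 ≤ δ := (norm_nonneg _).trans (hδ a a)
  induction l generalizing a with
  | nil => simpa [pathProd] using hδ b a
  | cons c l ih =>
    simp only [pathProd]
    refine (Matrix.linfty_opNorm_mul _ _).trans ?_
    rw [List.length_cons, pow_succ]
    gcongr
    · exact ih c
    · exact hδ c a

theorem norm_wordTrace_le {δ : ℝ} (hδ : ∀ e e', ‖u.block e e'‖ ≤ δ) {R : ℕ} (hR : ∀ e, r e ≤ R)
    (c : List H.DirEdge) : ‖u.wordTrace c‖ ≤ R * δ ^ c.length := by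
  cases c with
  | nil => simp [wordTrace]
  | cons e l =>
    refine (Matrix.norm_trace_le _).trans ?_
    rw [Fintype.card_fin]
    have := hR e
    gcongr
    exact u.norm_pathProd_le hδ e e l

end Norm

end Weight

/-! ### Convergence of the Euler product for small weights. -/

theorem summable_pow_length {E : Type*} [Fintype E] {δ : ℝ} (h0 : 0 ≤ δ)
    (h : Fintype.card E * δ < 1) : Summable fun c : List E => δ ^ c.length := by
  rw [← List.equivSigmaTuple.symm.summable_iff]
  refine (summable_sigma_of_nonneg fun _ => pow_nonneg h0 _).2 ⟨fun _ => Summable.of_finite, ?_⟩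
  have : ∀ k : ℕ, ∑' v : Fin k → E, ((fun c : List E => δ ^ c.length) ∘
      List.equivSigmaTuple.symm) ⟨k, v⟩ = (Fintype.card E * δ) ^ k := by
    intro k
    rw [tsum_fintype]
    simp [List.equivSigmaTuple, mul_pow]
  exact (summable_congr this).2 (summable_geometric_of_lt_one (by positivity) h)

namespace Weight

variable (u : H.Weight r)

-- The family `T` is summed in two ways, by length and by prime cycle. Absolute convergence, from at
-- most `R * δ ^ k` for each of the `|E| ^ k` words of length `k`, justifies both groupings, and
-- exponentiating turns the sum over prime cycles into the Euler product.
open scoped Matrix.Norms.Operator in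
theorem hasProd_inv_cycleDet {δ : ℝ} (hδ : ∀ e e', ‖u.block e e'‖ ≤ δ) (h0 : 0 ≤ δ)
    (h1 : δ < 1) (hE : Fintype.card H.DirEdge * δ < 1) (hM : ‖u.edgeMatrix‖ < 1) :
    HasProd (fun p : H.PrimeCycle => (u.cycleDet p)⁻¹) ((1 - u.edgeMatrix).det)⁻¹ := by
  obtain ⟨s, hs, hdet⟩ := Matrix.exists_hasSum_trace_pow u.edgeMatrix hM
  -- The empty word contributes `0 / 0 = 0`.
  let T : List H.DirEdge → ℂ := fun c => u.wordTrace c / c.length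
  obtain ⟨R, hR⟩ : ∃ R, ∀ e, r e ≤ R := ⟨∑ e, r e, fun e =>
    Finset.single_le_sum (f := r) (fun _ _ => Nat.zero_le _) (Finset.mem_univ e)⟩
  have hT : Summable T := by
    refine Summable.of_norm_bounded ((summable_pow_length h0 hE).mul_left (R : ℝ)) fun c => ?_
    rw [norm_div]
    rcases Nat.eq_zero_or_pos c.length with hc | hc
    · rw [hc]; simp
    · refine (div_le_self (norm_nonneg _) ?_).trans (u.norm_wordTrace_le hδ hR c)
      rw [Complex.norm_natCast]; exact_mod_cast hc
  have hTs : HasSum T s := by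
    have h2 := hT.hasSum
    rw [← List.equivSigmaTuple.symm.hasSum_iff] at h2
    have h3 := h2.sigma fun k => hasSum_fintype _
    rw [← hasSum_nat_add_iff' 1] at h3
    simp only [Finset.range_one, Finset.sum_singleton] at h3
    have h4 : ∀ k : ℕ, ∑ v : Fin (k + 1) → H.DirEdge, (T ∘ List.equivSigmaTuple.symm) ⟨k + 1, v⟩ =
        (u.edgeMatrix ^ (k + 1)).trace / (k + 1) := by
      intro k
      rw [← sum_wordTrace_eq_trace_pow, Finset.sum_div]
      refine Finset.sum_congr rfl fun v _ => ?_
      simp [T, List.equivSigmaTuple]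
    have h5 : ∑ v : Fin 0 → H.DirEdge, (T ∘ List.equivSigmaTuple.symm) ⟨0, v⟩ = 0 := by
      simp [T, List.equivSigmaTuple]
    rw [h5, sub_zero] at h3
    simp_rw [h4] at h3
    rw [← h3.unique hs]
    exact hT.hasSum
  have hTp : HasSum (T ∘ PrimeCycle.toGeodesic) s := by
    rw [PrimeCycle.toGeodesic_injective.hasSum_iff]
    · exact hTs
    · intro c hc
      by_contra h
      refine hc (u.isClosedGeodesic_of_wordTrace_ne_zero fun h0 => h ?_).mem_range_toGeodesic
      simp [T, h0]
  have key : ∀ p : H.PrimeCycle, ∃ a : ℂ,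
      HasSum (fun m => (T ∘ PrimeCycle.toGeodesic) ⟨p, m⟩) a ∧
        (u.cycleDet p)⁻¹ = Complex.exp a := by
    intro p
    have hne := p.isPrimeGeodesic_rep.length_pos
    obtain ⟨e, l, hp⟩ := List.exists_cons_of_length_pos hne
    obtain ⟨a, ha, hda⟩ := Matrix.exists_hasSum_trace_pow (u.pathProd e l e)
      ((u.norm_pathProd_le hδ e e l).trans_lt (pow_lt_one₀ h0 h1 (by simp)))
    refine ⟨a, ?_, ?_⟩
    · have hsm : Summable fun m => (T ∘ PrimeCycle.toGeodesic) ⟨p, m⟩ :=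
        hTp.summable.sigma_factor p
      have h6 := hsm.hasSum.prod_fiberwise fun m => hasSum_fintype _
      -- The starting points on the cycle all contribute the same term, so their number cancels the
      -- length of the prime geodesic in the denominator.
      have h7 : ∀ m : ℕ, ∑ j : Fin p.rep.length, (T ∘ PrimeCycle.toGeodesic) ⟨p, (m, j)⟩ =
          (u.pathProd e l e ^ (m + 1)).trace / (m + 1) := by
        intro m
        have h8 : ∀ j : Fin p.rep.length, (T ∘ PrimeCycle.toGeodesic) ⟨p, (m, j)⟩ =
            (u.pathProd e l e ^ (m + 1)).trace / ((m + 1) * p.rep.length) := by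
          intro j
          simp only [Function.comp, T, PrimeCycle.toGeodesic]
          rw [List.length_repeated, List.length_rotate, ← List.rotate_repeated,
            wordTrace_rotate, ← wordTrace_repeated, ← hp]
          push_cast; rfl
        have hne' : (p.rep.length : ℂ) ≠ 0 := by exact_mod_cast hne.ne'
        rw [Finset.sum_congr rfl fun j _ => h8 j]
        simp only [Finset.sum_const, Finset.card_univ, Fintype.card_fin, nsmul_eq_mul]
        have : ((m : ℂ) + 1) ≠ 0 := by exact_mod_cast Nat.succ_ne_zero m
        field_simp
      simp_rw [h7] at h6
      rw [ha.unique h6]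
      exact hsm.hasSum
    · have : u.cycleDet p = (1 - u.pathProd e l e).det := by
        change u.geodesicDet p.rep = _
        rw [hp]; rfl
      rw [this, hda, ← Complex.exp_neg, neg_neg]
  choose a ha hea using key
  have hsum : HasSum a s := hTp.sigma ha
  have := hsum.cexp
  rw [hdet, ← Complex.exp_neg, neg_neg]
  convert this using 1
  funext p
  exact hea p

end Weight

open scoped Matrix.Norms.Operator in
theorem eventually_hasProd_inv_cycleDet (H : FinHypergraph V) (r : H.DirEdge → ℕ) :
    ∀ᶠ u in 𝓝 (0 : H.Weight r),
      HasProd (fun p : H.PrimeCycle => (u.cycleDet p)⁻¹) ((1 - u.edgeMatrix).det)⁻¹ := by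
  set N : ℝ := ((Fintype.card (Σ e : H.DirEdge, Fin (r e)) : ℕ) : ℝ) with hN
  set n : ℝ := ((Fintype.card H.DirEdge : ℕ) : ℝ) with hn
  have hN0 : 0 ≤ N := Nat.cast_nonneg _
  have hn0 : 0 ≤ n := Nat.cast_nonneg _
  -- A block, and `M(u)` itself, has norm at most `N * ε` when all entries are at most `ε`. The
  -- choice gives both `N * ε < 1` and `n * (N * ε) < 1`; adding ones covers empty index sets.
  set ε : ℝ := ((N + 1) * (n + 1))⁻¹ with hε
  have hε0 : 0 < ε := by positivity
  have hNε : N * ε < (n + 1)⁻¹ := by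
    rw [hε, mul_inv, ← mul_assoc]
    refine mul_lt_of_lt_one_left (by positivity) ?_
    rw [← div_eq_mul_inv, div_lt_one (by positivity)]
    linarith
  have hle1 : (n + 1)⁻¹ ≤ 1 := inv_le_one_of_one_le₀ (by linarith)
  filter_upwards [Metric.ball_mem_nhds (0 : H.Weight r) hε0] with u hu
  have hu' : ‖u‖ ≤ ε := (mem_ball_zero_iff.1 hu).le
  have hb : ∀ e e' i j, ‖u.block e e' i j‖ ≤ ε := by
    intro e e' i j
    unfold Weight.block
    split_ifs with h
    · exact (norm_le_pi_norm (u ⟨(e', e), h⟩ i) j).trans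
        ((norm_le_pi_norm (u ⟨(e', e), h⟩) i).trans ((norm_le_pi_norm u ⟨(e', e), h⟩).trans hu'))
    · simpa using hε0.le
  refine u.hasProd_inv_cycleDet (δ := N * ε) (fun e e' => ?_) (by positivity)
    (hNε.trans_le hle1) ?_ ?_
  · refine (Matrix.norm_le_card_mul_of_forall_norm_le hε0.le (hb e e')).trans ?_
    gcongr
    rw [hN, Fintype.card_fin]
    simp only [Fintype.card_sigma, Fintype.card_fin]
    exact_mod_cast Finset.single_le_sum (f := r) (fun _ _ => Nat.zero_le _) (Finset.mem_univ e')
  · calc n * (N * ε) ≤ n * (n + 1)⁻¹ := by gcongr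
      _ < 1 := by rw [← div_eq_mul_inv, div_lt_one (by positivity)]; linarith
  · refine (Matrix.norm_le_card_mul_of_forall_norm_le hε0.le fun a b => ?_).trans_lt
      (hNε.trans_le hle1)
    exact hb a.1 b.1 a.2 b.2

-- Each entry of the matrix is a coordinate of `u` or zero, so the determinant is a polynomial.
-- Analyticity is obtained as smoothness of order `ω`.
open scoped ContDiff in
theorem analyticOnNhd_det_one_sub_edgeMatrix (H : FinHypergraph V) (r : H.DirEdge → ℕ) :
    AnalyticOnNhd ℂ (fun u : H.Weight r => (1 - u.edgeMatrix).det) Set.univ := by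
  rw [← contDiff_omega_iff_analyticOnNhd]
  simp only [Matrix.det_apply]
  refine ContDiff.sum fun σ _ => ContDiff.const_smul _ (contDiff_prod fun a _ => ?_)
  simp only [Matrix.sub_apply]
  refine contDiff_const.sub ?_
  by_cases h : H.Follows a.1 (σ a).1
  · simp only [Weight.edgeMatrix, Weight.block, h, dite_true, Matrix.of_apply]
    have h1 : ContDiff ℂ ω fun u : H.Weight r => u := contDiff_id
    exact contDiff_pi.1 (contDiff_pi.1 (contDiff_pi.1 h1 ⟨(a.1, (σ a).1), h⟩) _) _
  · simp only [Weight.edgeMatrix, Weight.block, h, dite_false, Matrix.of_apply,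
      Matrix.zero_apply]
    exact contDiff_const

theorem isReciprocalZeta_det (H : FinHypergraph V) (r : H.DirEdge → ℕ) :
    H.IsReciprocalZeta r fun u => (1 - u.edgeMatrix).det := by
  refine ⟨analyticOnNhd_det_one_sub_edgeMatrix H r, ?_⟩
  filter_upwards [eventually_hasProd_inv_cycleDet H r] with u hu
  exact ⟨hu.multipliable, by rw [Weight.eulerProduct, hu.tprod_eq, inv_inv]⟩

/-- Near `0` both functions are the reciprocal of the same Euler product, and the identity theorem
applies on the whole (connected) space of weights. -/
theorem IsReciprocalZeta.eq_det {Z : H.Weight r → ℂ} (hZ : H.IsReciprocalZeta r Z) :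
    Z = fun u => (1 - u.edgeMatrix).det := by
  refine hZ.1.eq_of_eventuallyEq (isReciprocalZeta_det H r).1 (z₀ := 0) ?_
  filter_upwards [hZ.2, (isReciprocalZeta_det H r).2] with u h1 h2
  rw [h1.2, h2.2]

end FinHypergraph

/-! ### Moments of exponential families -/

/-- The pairing `v ↦ (w ↦ ⟨v, w⟩)` as a continuous linear map. -/
noncomputable def dotCLM (ι : Type*) [Fintype ι] : (ι → ℝ) →L[ℝ] (ι → ℝ) →L[ℝ] ℝ :=
  ∑ k, (ContinuousLinearMap.proj (R := ℝ) (φ := fun _ : ι => ℝ) k).smulRight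
    (ContinuousLinearMap.proj (R := ℝ) (φ := fun _ : ι => ℝ) k)

theorem dotCLM_apply {ι : Type*} [Fintype ι] (v w : ι → ℝ) : dotCLM ι v w = v ⬝ᵥ w := by
  simp [dotCLM, dotProduct]

theorem dotCLM_eq_sum {ι : Type*} [Fintype ι] (v : ι → ℝ) :
    dotCLM ι v = ∑ k, v k • ContinuousLinearMap.proj (R := ℝ) (φ := fun _ : ι => ℝ) k := by
  simp [dotCLM]

theorem abs_dotProduct_le {ι : Type*} [Fintype ι] (v w : ι → ℝ) :
    |v ⬝ᵥ w| ≤ ‖v‖ * ∑ k, |w k| := by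
  rw [dotProduct, Finset.mul_sum]
  refine (Finset.abs_sum_le_sum_abs _ _).trans (Finset.sum_le_sum fun k _ => ?_)
  rw [abs_mul]
  gcongr
  exact norm_le_pi_norm v k

theorem norm_dotCLM_le {ι : Type*} [Fintype ι] (v : ι → ℝ) : ‖dotCLM ι v‖ ≤ ∑ k, |v k| := by
  refine ContinuousLinearMap.opNorm_le_bound _ (Finset.sum_nonneg fun _ _ => abs_nonneg _)
    fun w => ?_
  rw [dotCLM_apply, dotProduct_comm, mul_comm]
  exact abs_dotProduct_le w v

namespace ExpFamily

variable {X : Type*} [MeasurableSpace X] {ι : Type*} [Fintype ι] (E : ExpFamily X ι)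

/-- Functions that grow more slowly than `exp (ε ∑ |φ_k|)` for every `ε > 0`. -/
def IsSubexp (g : X → ℝ) : Prop :=
  Measurable g ∧ ∀ ε : ℝ, 0 < ε → ∃ C : ℝ, 0 ≤ C ∧
    ∀ x, |g x| ≤ C * Real.exp (ε * ∑ k, |E.stat x k|)

/-- The unnormalized moment `∫ g(x) exp ⟨θ, φ(x)⟩ dν(x)`. -/
noncomputable def moment (g : X → ℝ) (θ : ι → ℝ) : ℝ :=
  ∫ x, g x * Real.exp (θ ⬝ᵥ E.stat x) ∂E.base

variable {E}

/-- Each differentiation of a moment multiplies the integrand by a component of `φ`; closure under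
products keeps the class stable under this. -/
theorem IsSubexp.mul {g h : X → ℝ} (hg : E.IsSubexp g) (hh : E.IsSubexp h) :
    E.IsSubexp (fun x => g x * h x) := by
  refine ⟨hg.1.mul hh.1, fun ε hε => ?_⟩
  obtain ⟨C, hC, h1⟩ := hg.2 (ε / 2) (half_pos hε)
  obtain ⟨D, hD, h2⟩ := hh.2 (ε / 2) (half_pos hε)
  refine ⟨C * D, mul_nonneg hC hD, fun x => ?_⟩
  rw [abs_mul]
  calc |g x| * |h x| ≤ (C * Real.exp (ε / 2 * ∑ k, |E.stat x k|)) *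
        (D * Real.exp (ε / 2 * ∑ k, |E.stat x k|)) := by
        gcongr
        exacts [h1 x, h2 x]
    _ = C * D * Real.exp (ε * ∑ k, |E.stat x k|) := by
        rw [mul_mul_mul_comm, ← Real.exp_add]; ring_nf

theorem isSubexp_const (c : ℝ) : E.IsSubexp fun _ => c := by
  refine ⟨measurable_const, fun ε hε => ⟨|c|, abs_nonneg _, fun x => ?_⟩⟩
  refine le_mul_of_one_le_right (abs_nonneg _) (Real.one_le_exp ?_)
  exact mul_nonneg hε.le (Finset.sum_nonneg fun _ _ => abs_nonneg _)

theorem le_inv_mul_exp {ε t : ℝ} (hε : 0 < ε) : t ≤ ε⁻¹ * Real.exp (ε * t) := by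
  have h := Real.add_one_le_exp (ε * t)
  rw [← div_eq_inv_mul, le_div_iff₀ hε]
  linarith

theorem isSubexp_stat (hE : Measurable E.stat) (k : ι) : E.IsSubexp fun x => E.stat x k := by
  refine ⟨(measurable_pi_apply k).comp hE, fun ε hε => ⟨ε⁻¹, by positivity, fun x => ?_⟩⟩
  have h1 : |E.stat x k| ≤ ∑ k, |E.stat x k| :=
    Finset.single_le_sum (f := fun k => |E.stat x k|) (fun _ _ => abs_nonneg _) (Finset.mem_univ k)
  exact h1.trans (le_inv_mul_exp hε)

theorem measurable_dotProduct_stat (hE : Measurable E.stat) (θ : ι → ℝ) :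
    Measurable fun x => θ ⬝ᵥ E.stat x := by
  have h : ∀ k, Measurable fun x => E.stat x k := fun k => (measurable_pi_apply k).comp hE
  unfold dotProduct
  fun_prop

theorem integrable_exp_of_partition_lt_top (hE : Measurable E.stat) {θ : ι → ℝ}
    (h : E.partition θ < ⊤) : Integrable (fun x => Real.exp (θ ⬝ᵥ E.stat x)) E.base := by
  refine ⟨(measurable_dotProduct_stat hE θ).exp.aestronglyMeasurable, ?_⟩
  rw [hasFiniteIntegral_iff_ofReal (Filter.Eventually.of_forall fun _ => (Real.exp_pos _).le)]
  exact h

/-- As `θ` is interior, all the parameters with coordinates `θ_k ± ε / 2` have finite partition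
functions. At each `x` the choice of signs matching `φ(x)` reproduces the integrand, which is thus
dominated by the finite sum over all choices. -/
theorem exists_integrable_exp_add (hE : Measurable E.stat) {θ : ι → ℝ} (hθ : θ ∈ E.paramSet) :
    ∃ ε > 0, Integrable (fun x => Real.exp (θ ⬝ᵥ E.stat x + ε * ∑ k, |E.stat x k|)) E.base := by
  classical
  obtain ⟨ε, hε, hb⟩ := Metric.mem_nhds_iff.1 (mem_interior_iff_mem_nhds.1 hθ)
  refine ⟨ε / 2, half_pos hε, ?_⟩
  let s : (ι → Bool) → ι → ℝ := fun b k => if b k then ε / 2 else -(ε / 2)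
  have hs : ∀ b, θ + s b ∈ {θ | E.partition θ < ⊤} := by
    intro b
    apply hb
    rw [mem_ball_iff_norm, add_sub_cancel_left]
    refine lt_of_le_of_lt ?_ (half_lt_self hε)
    refine (pi_norm_le_iff_of_nonneg (half_pos hε).le).2 fun k => ?_
    simp only [s]
    split_ifs <;> simp [abs_of_pos hε]
  have hint : Integrable (fun x => ∑ b, Real.exp ((θ + s b) ⬝ᵥ E.stat x)) E.base :=
    integrable_finsetSum _ fun b _ => integrable_exp_of_partition_lt_top hE (hs b)
  refine hint.mono' ?_ (Filter.Eventually.of_forall fun x => ?_)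
  · have h : ∀ k, Measurable fun x => E.stat x k := fun k => (measurable_pi_apply k).comp hE
    have := measurable_dotProduct_stat hE θ
    have h2 : Measurable fun x => ∑ k, |E.stat x k| :=
      Finset.measurable_fun_sum _ fun k _ => (h k).abs
    exact (this.add (h2.const_mul _)).exp.aestronglyMeasurable
  · rw [Real.norm_eq_abs, abs_of_pos (Real.exp_pos _)]
    let b : ι → Bool := fun k => decide (0 ≤ E.stat x k)
    have : θ ⬝ᵥ E.stat x + ε / 2 * ∑ k, |E.stat x k| = (θ + s b) ⬝ᵥ E.stat x := by
      rw [add_dotProduct, Finset.mul_sum]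
      congr 1
      refine Finset.sum_congr rfl fun k _ => ?_
      by_cases h : 0 ≤ E.stat x k
      · simp [s, b, h, abs_of_nonneg h]
      · simp [s, b, h, abs_of_neg (not_le.1 h)]
    rw [this]
    exact Finset.single_le_sum (f := fun b => Real.exp ((θ + s b) ⬝ᵥ E.stat x))
      (fun _ _ => (Real.exp_pos _).le) (Finset.mem_univ b)

theorem IsSubexp.integrable (hE : Measurable E.stat) {g : X → ℝ} (hg : E.IsSubexp g)
    {θ : ι → ℝ} (hθ : θ ∈ E.paramSet) :
    Integrable (fun x => g x * Real.exp (θ ⬝ᵥ E.stat x)) E.base := by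
  obtain ⟨ε, hε, hint⟩ := exists_integrable_exp_add hE hθ
  obtain ⟨C, hC, hb⟩ := hg.2 ε hε
  refine (hint.const_mul C).mono'
    (hg.1.mul (measurable_dotProduct_stat hE θ).exp).aestronglyMeasurable
    (Filter.Eventually.of_forall fun x => ?_)
  rw [norm_mul, Real.norm_eq_abs, Real.norm_eq_abs, Real.abs_exp, Real.exp_add,
    mul_comm (Real.exp _) (Real.exp _), ← mul_assoc]
  gcongr
  exact hb x

theorem IsSubexp.hasFDerivAt_moment (hE : Measurable E.stat) {g : X → ℝ} (hg : E.IsSubexp g)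
    {θ : ι → ℝ} (hθ : θ ∈ E.paramSet) :
    HasFDerivAt (E.moment g)
      (dotCLM ι fun k => E.moment (fun x => g x * E.stat x k) θ) θ := by
  obtain ⟨ε, hε, hint⟩ := exists_integrable_exp_add hE hθ
  -- The margin `ε` is shared in three: for the growth of `g`, for moving `θ'` away from `θ`, and
  -- for the factor `φ` produced by the derivative.
  have hε3 : 0 < ε / 3 := by positivity
  obtain ⟨C, hC, hb⟩ := hg.2 (ε / 3) hε3
  have hmeas : ∀ θ', AEStronglyMeasurable (fun x => g x * Real.exp (θ' ⬝ᵥ E.stat x)) E.base :=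
    fun θ' => (hg.1.mul (measurable_dotProduct_stat hE θ').exp).aestronglyMeasurable
  have hcoord : ∀ k, Integrable (fun x => g x * E.stat x k * Real.exp (θ ⬝ᵥ E.stat x)) E.base :=
    fun k => (hg.mul (isSubexp_stat hE k)).integrable hE hθ
  have hF' : ∀ θ' x, (g x * Real.exp (θ' ⬝ᵥ E.stat x)) • dotCLM ι (E.stat x) =
      ∑ k, (g x * E.stat x k * Real.exp (θ' ⬝ᵥ E.stat x)) •
        ContinuousLinearMap.proj (R := ℝ) (φ := fun _ : ι => ℝ) k := by
    intro θ' x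
    rw [dotCLM_eq_sum, Finset.smul_sum]
    refine Finset.sum_congr rfl fun k _ => ?_
    rw [smul_smul]; ring_nf
  have hcoord' : ∀ k ∈ Finset.univ, Integrable (fun x =>
      (g x * E.stat x k * Real.exp (θ ⬝ᵥ E.stat x)) •
        ContinuousLinearMap.proj (R := ℝ) (φ := fun _ : ι => ℝ) k) E.base :=
    fun k _ => (hcoord k).smul_const _
  have key := hasFDerivAt_integral_of_dominated_of_fderiv_le (𝕜 := ℝ) (μ := E.base)
    (F := fun θ' x => g x * Real.exp (θ' ⬝ᵥ E.stat x))
    (F' := fun θ' x => (g x * Real.exp (θ' ⬝ᵥ E.stat x)) • dotCLM ι (E.stat x))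
    (x₀ := θ) (s := Metric.ball θ (ε / 3))
    (bound := fun x => C * (ε / 3)⁻¹ * Real.exp (θ ⬝ᵥ E.stat x + ε * ∑ k, |E.stat x k|))
    (Metric.ball_mem_nhds θ hε3) (Filter.Eventually.of_forall hmeas)
    (hg.integrable hE hθ) ?_ ?_ (hint.const_mul _) ?_
  · have h2 : ∫ x, (g x * Real.exp (θ ⬝ᵥ E.stat x)) • dotCLM ι (E.stat x) ∂E.base =
        dotCLM ι fun k => E.moment (fun x => g x * E.stat x k) θ := by
      simp_rw [hF']
      rw [integral_finsetSum _ hcoord', dotCLM_eq_sum]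
      refine Finset.sum_congr rfl fun k _ => ?_
      rw [integral_smul_const]
      rfl
    rw [← h2]
    exact key
  · exact (hmeas θ).smul ((dotCLM ι).continuous.comp_aestronglyMeasurable hE.aestronglyMeasurable)
  · refine Filter.Eventually.of_forall fun x θ' hθ' => ?_
    set S := ∑ k, |E.stat x k| with hS
    have hS0 : 0 ≤ S := Finset.sum_nonneg fun _ _ => abs_nonneg _
    rw [norm_smul, norm_mul, Real.norm_eq_abs, Real.norm_eq_abs, Real.abs_exp]
    have h1 : θ' ⬝ᵥ E.stat x ≤ θ ⬝ᵥ E.stat x + ε / 3 * S := by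
      have h3 := (le_abs_self _).trans (abs_dotProduct_le (θ' - θ) (E.stat x))
      rw [sub_dotProduct] at h3
      have h4 : ‖θ' - θ‖ * S ≤ ε / 3 * S := by
        gcongr
        exact (mem_ball_iff_norm.1 hθ').le
      linarith
    calc |g x| * Real.exp (θ' ⬝ᵥ E.stat x) * ‖dotCLM ι (E.stat x)‖
        ≤ (C * Real.exp (ε / 3 * S)) * Real.exp (θ ⬝ᵥ E.stat x + ε / 3 * S) *
          ((ε / 3)⁻¹ * Real.exp (ε / 3 * S)) := by
          gcongr
          · exact hb x
          · exact (norm_dotCLM_le _).trans (le_inv_mul_exp hε3)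
      _ = C * (ε / 3)⁻¹ * (Real.exp (ε / 3 * S) * Real.exp (θ ⬝ᵥ E.stat x + ε / 3 * S) *
          Real.exp (ε / 3 * S)) := by ring
      _ = C * (ε / 3)⁻¹ * Real.exp (θ ⬝ᵥ E.stat x + ε * S) := by
          rw [← Real.exp_add, ← Real.exp_add]; ring_nf
  · refine Filter.Eventually.of_forall fun x θ' _ => ?_
    have h1 : HasFDerivAt (fun θ' : ι → ℝ => θ' ⬝ᵥ E.stat x) (dotCLM ι (E.stat x)) θ' := by
      have := (dotCLM ι (E.stat x)).hasFDerivAt (x := θ')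
      refine this.congr_of_eventuallyEq (Filter.Eventually.of_forall fun v => ?_)
      simp only
      rw [dotCLM_apply, dotProduct_comm]
    have := (h1.exp).const_mul (g x)
    rwa [smul_smul] at this

theorem isOpen_paramSet : IsOpen E.paramSet := isOpen_interior

theorem IsSubexp.contDiffOn_moment (hE : Measurable E.stat) {g : X → ℝ} (hg : E.IsSubexp g)
    (n : ℕ) : ContDiffOn ℝ n (E.moment g) E.paramSet := by
  induction n generalizing g with
  | zero =>
    exact contDiffOn_zero.2 fun θ hθ =>
      (hg.hasFDerivAt_moment hE hθ).continuousAt.continuousWithinAt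
  | succ n ih =>
    push_cast
    rw [contDiffOn_succ_iff_fderiv_of_isOpen isOpen_paramSet]
    refine ⟨fun θ hθ =>
      (hg.hasFDerivAt_moment hE hθ).differentiableAt.differentiableWithinAt, by simp, ?_⟩
    have : ContDiffOn ℝ n
        (fun θ => dotCLM ι fun k => E.moment (fun x => g x * E.stat x k) θ) E.paramSet := by
      refine (dotCLM ι).contDiff.comp_contDiffOn (contDiffOn_pi.2 fun k => ?_)
      exact ih (hg.mul (isSubexp_stat hE k))
    exact this.congr fun θ hθ => (hg.hasFDerivAt_moment hE hθ).fderiv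

end ExpFamily

/-! ### Cumulants and the mean map -/

namespace ExpFamily

variable {X : Type*} [MeasurableSpace X] {ι : Type*} [Fintype ι] {E : ExpFamily X ι}

theorem logPartition_eq_log_moment (hE : Measurable E.stat) (θ : ι → ℝ) :
    E.logPartition θ = Real.log (E.moment (fun _ => 1) θ) := by
  rw [logPartition, partition, moment]
  simp only [one_mul]
  rw [integral_eq_lintegral_of_nonneg_ae
    (Filter.Eventually.of_forall fun _ => (Real.exp_pos _).le)
    (measurable_dotProduct_stat hE θ).exp.aestronglyMeasurable]

theorem moment_one_pos (hE : Measurable E.stat) (h0 : E.base ≠ 0) {θ : ι → ℝ}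
    (hθ : θ ∈ E.paramSet) : 0 < E.moment (fun _ => 1) θ := by
  have : NeZero E.base := ⟨h0⟩
  have h := (isSubexp_const (E := E) 1).integrable hE hθ
  simp only [one_mul] at h
  simpa [moment] using integral_exp_pos h

theorem exp_logPartition (hE : Measurable E.stat) (h0 : E.base ≠ 0) {θ : ι → ℝ}
    (hθ : θ ∈ E.paramSet) : Real.exp (E.logPartition θ) = E.moment (fun _ => 1) θ := by
  rw [logPartition_eq_log_moment hE, Real.exp_log (moment_one_pos hE h0 hθ)]

theorem measurable_density (hE : Measurable E.stat) (θ : ι → ℝ) :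
    Measurable fun x => ENNReal.ofReal (E.density θ x) :=
  ((measurable_dotProduct_stat hE θ).sub_const _).exp.ennreal_ofReal

theorem toReal_density_smul (hE : Measurable E.stat) (h0 : E.base ≠ 0) {θ : ι → ℝ}
    (hθ : θ ∈ E.paramSet) (g : X → ℝ) (x : X) :
    (ENNReal.ofReal (E.density θ x)).toReal • g x =
      (g x * Real.exp (θ ⬝ᵥ E.stat x)) / E.moment (fun _ => 1) θ := by
  rw [density, ENNReal.toReal_ofReal (Real.exp_pos _).le, Real.exp_sub, exp_logPartition hE h0 hθ,
    smul_eq_mul]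
  ring

theorem integral_law (hE : Measurable E.stat) (h0 : E.base ≠ 0) {θ : ι → ℝ}
    (hθ : θ ∈ E.paramSet) (g : X → ℝ) :
    ∫ x, g x ∂E.law θ = E.moment g θ / E.moment (fun _ => 1) θ := by
  rw [law, integral_withDensity_eq_integral_toReal_smul (measurable_density hE θ)
    (Filter.Eventually.of_forall fun _ => ENNReal.ofReal_lt_top)]
  simp_rw [toReal_density_smul hE h0 hθ]
  rw [integral_div]
  rfl

theorem integrable_law_iff (hE : Measurable E.stat) (h0 : E.base ≠ 0) {θ : ι → ℝ}
    (hθ : θ ∈ E.paramSet) {g : X → ℝ} :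
    Integrable g (E.law θ) ↔ Integrable (fun x => g x * Real.exp (θ ⬝ᵥ E.stat x)) E.base := by
  rw [law, integrable_withDensity_iff_integrable_smul' (measurable_density hE θ)
    (Filter.Eventually.of_forall fun _ => ENNReal.ofReal_lt_top)]
  simp_rw [toReal_density_smul hE h0 hθ, div_eq_mul_inv]
  exact integrable_mul_const_iff (isUnit_iff_ne_zero.2
    (inv_ne_zero (moment_one_pos hE h0 hθ).ne')) _

theorem IsSubexp.integrable_law (hE : Measurable E.stat) (h0 : E.base ≠ 0) {θ : ι → ℝ}
    (hθ : θ ∈ E.paramSet) {g : X → ℝ} (hg : E.IsSubexp g) : Integrable g (E.law θ) :=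
  (integrable_law_iff hE h0 hθ).2 (hg.integrable hE hθ)

theorem isProbabilityMeasure_law (hE : Measurable E.stat) (h0 : E.base ≠ 0) {θ : ι → ℝ}
    (hθ : θ ∈ E.paramSet) : IsProbabilityMeasure (E.law θ) := by
  have h1 : Integrable (fun _ : X => (1 : ℝ)) (E.law θ) :=
    (isSubexp_const 1).integrable_law hE h0 hθ
  have hfin : IsFiniteMeasure (E.law θ) := by
    rw [integrable_const_iff] at h1
    simpa using h1
  have h2 := integral_law hE h0 hθ fun _ => 1
  rw [div_self (moment_one_pos hE h0 hθ).ne', integral_const, smul_eq_mul, mul_one] at h2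
  constructor
  rw [Measure.real, ENNReal.toReal_eq_one_iff] at h2
  exact h2

theorem memLp_stat (hE : Measurable E.stat) (h0 : E.base ≠ 0) {θ : ι → ℝ}
    (hθ : θ ∈ E.paramSet) (k : ι) : MemLp (fun x => E.stat x k) 2 (E.law θ) := by
  have hs := isSubexp_stat hE k
  rw [memLp_two_iff_integrable_sq hs.1.aestronglyMeasurable]
  simpa [sq] using (hs.mul hs).integrable_law hE h0 hθ

theorem varMatrix_law_apply (hE : Measurable E.stat) (h0 : E.base ≠ 0) {θ : ι → ℝ}
    (hθ : θ ∈ E.paramSet) (a b : ι) :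
    varMatrix (E.law θ) E.stat a b =
      E.moment (fun x => E.stat x a * E.stat x b) θ / E.moment (fun _ => 1) θ -
      E.moment (fun x => E.stat x a) θ / E.moment (fun _ => 1) θ *
        (E.moment (fun x => E.stat x b) θ / E.moment (fun _ => 1) θ) := by
  have := isProbabilityMeasure_law hE h0 hθ
  rw [varMatrix, covMatrix, Matrix.of_apply,
    covariance_eq_sub (memLp_stat hE h0 hθ a) (memLp_stat hE h0 hθ b),
    integral_law hE h0 hθ, integral_law hE h0 hθ, integral_law hE h0 hθ]
  rfl

theorem meanMap_apply (hE : Measurable E.stat) (h0 : E.base ≠ 0) {θ : ι → ℝ}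
    (hθ : θ ∈ E.paramSet) (k : ι) :
    E.meanMap θ k = E.moment (fun x => E.stat x k) θ / E.moment (fun _ => 1) θ :=
  integral_law hE h0 hθ _

theorem hasFDerivAt_logPartition (hE : Measurable E.stat) (h0 : E.base ≠ 0) {θ : ι → ℝ}
    (hθ : θ ∈ E.paramSet) : HasFDerivAt E.logPartition (dotCLM ι (E.meanMap θ)) θ := by
  have h1 := ((isSubexp_const (E := E) 1).hasFDerivAt_moment hE hθ).log
    (moment_one_pos hE h0 hθ).ne'
  have h2 : E.logPartition = fun θ => Real.log (E.moment (fun _ => 1) θ) :=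
    funext (logPartition_eq_log_moment hE)
  rw [h2]
  refine h1.congr_fderiv ?_
  rw [← map_smul]
  congr 1
  funext k
  rw [meanMap_apply hE h0 hθ, Pi.smul_apply, smul_eq_mul, div_eq_inv_mul]
  simp only [one_mul]

theorem contDiffAt_logPartition (hE : Measurable E.stat) (h0 : E.base ≠ 0) {θ : ι → ℝ}
    (hθ : θ ∈ E.paramSet) (n : ℕ) : ContDiffAt ℝ n E.logPartition θ := by
  have h2 : E.logPartition = fun θ => Real.log (E.moment (fun _ => 1) θ) :=
    funext (logPartition_eq_log_moment hE)
  rw [h2]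
  exact (((isSubexp_const 1).contDiffOn_moment hE n).contDiffAt
    (isOpen_paramSet.mem_nhds hθ)).log (moment_one_pos hE h0 hθ).ne'

theorem contDiffAt_meanMap (hE : Measurable E.stat) (h0 : E.base ≠ 0) {θ : ι → ℝ}
    (hθ : θ ∈ E.paramSet) (n : ℕ) : ContDiffAt ℝ n E.meanMap θ := by
  have hn := isOpen_paramSet.mem_nhds hθ
  refine contDiffAt_pi.2 fun k => ?_
  have h : ContDiffAt ℝ n
      (fun θ => E.moment (fun x => E.stat x k) θ / E.moment (fun _ => 1) θ) θ :=
    (((isSubexp_stat hE k).contDiffOn_moment hE n).contDiffAt hn).div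
      (((isSubexp_const 1).contDiffOn_moment hE n).contDiffAt hn) (moment_one_pos hE h0 hθ).ne'
  refine h.congr_of_eventuallyEq ?_
  filter_upwards [hn] with θ' hθ'
  exact meanMap_apply hE h0 hθ' k

theorem hasFDerivAt_meanMap [DecidableEq ι] (hE : Measurable E.stat) (h0 : E.base ≠ 0) {θ : ι → ℝ}
    (hθ : θ ∈ E.paramSet) :
    HasFDerivAt E.meanMap (toLin' (varMatrix (E.law θ) E.stat)).toContinuousLinearMap θ := by
  have hn := isOpen_paramSet.mem_nhds hθ
  have hpos := (moment_one_pos hE h0 hθ).ne'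
  refine hasFDerivAt_pi'.2 fun k => ?_
  have h1 := ((isSubexp_stat hE k).hasFDerivAt_moment hE hθ).mul
    ((hasDerivAt_inv hpos).comp_hasFDerivAt θ ((isSubexp_const 1).hasFDerivAt_moment hE hθ))
  refine (h1.congr_fderiv ?_).congr_of_eventuallyEq ?_
  · ext w
    simp only [_root_.smul_apply, _root_.add_apply, dotCLM_apply,
      Function.comp_apply,
      ContinuousLinearMap.comp_apply, LinearMap.coe_toContinuousLinearMap', toLin'_apply,
      ContinuousLinearMap.proj_apply, smul_eq_mul, mulVec]
    simp only [dotProduct, Finset.mul_sum, ← Finset.sum_add_distrib]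
    refine Finset.sum_congr rfl fun a _ => ?_
    rw [varMatrix_law_apply hE h0 hθ]
    simp only [one_mul]
    field_simp
    ring
  · filter_upwards [hn] with θ' hθ'
    exact meanMap_apply hE h0 hθ' k

theorem isSymm_varMatrix {κ : Type*} (μ : Measure X) (f : X → κ → ℝ) : (varMatrix μ f).IsSymm := by
  ext a b
  exact covariance_comm _ _

/-- Converts the assumed invertibility of the Hessians into invertibility of the covariance
matrices. -/
theorem hessian_logPartition [DecidableEq ι] (hE : Measurable E.stat) (h0 : E.base ≠ 0)
    {θ : ι → ℝ} (hθ : θ ∈ E.paramSet) :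
    hessian E.logPartition θ = varMatrix (E.law θ) E.stat := by
  have h1 : fderiv ℝ E.logPartition =ᶠ[𝓝 θ] fun θ => dotCLM ι (E.meanMap θ) := by
    filter_upwards [isOpen_paramSet.mem_nhds hθ] with θ' hθ'
    exact (hasFDerivAt_logPartition hE h0 hθ').fderiv
  have h2 := (dotCLM ι).hasFDerivAt.comp θ (hasFDerivAt_meanMap hE h0 hθ)
  ext a b
  rw [hessian, Matrix.of_apply, h1.fderiv_eq]
  change (fderiv ℝ (dotCLM ι ∘ E.meanMap) θ) _ _ = _
  rw [h2.fderiv, ContinuousLinearMap.comp_apply, dotCLM_apply]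
  simp [(isSymm_varMatrix (E.law θ) E.stat).apply a b]

theorem mulVec_varMatrix_law (hE : Measurable E.stat) (h0 : E.base ≠ 0) {θ : ι → ℝ}
    (hθ : θ ∈ E.paramSet) (v : ι → ℝ) (k : ι) :
    (varMatrix (E.law θ) E.stat *ᵥ v) k =
      cov[fun x => E.stat x k, fun x => v ⬝ᵥ E.stat x; E.law θ] := by
  have := isProbabilityMeasure_law hE h0 hθ
  simp only [dotProduct]
  rw [covariance_fun_sum_right (X := fun a x => v a * E.stat x a)
    (fun a => (memLp_stat hE h0 hθ a).const_mul (v a)) (memLp_stat hE h0 hθ k)]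
  simp only [mulVec, dotProduct, covariance_const_mul_right]
  exact Finset.sum_congr rfl fun a _ => mul_comm _ _

end ExpFamily

/-! ### The Legendre transform -/

namespace ExpFamily

variable {X : Type*} [MeasurableSpace X] {ι : Type*} [Fintype ι] {E : ExpFamily X ι}

theorem integral_dotProduct_stat (hE : Measurable E.stat) (h0 : E.base ≠ 0) {θ : ι → ℝ}
    (hθ : θ ∈ E.paramSet) (v : ι → ℝ) :
    Integrable (fun x => v ⬝ᵥ E.stat x) (E.law θ) ∧
      ∫ x, v ⬝ᵥ E.stat x ∂E.law θ = v ⬝ᵥ E.meanMap θ := by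
  have h : ∀ k ∈ Finset.univ, Integrable (fun x => v k * E.stat x k) (E.law θ) := fun k _ =>
    ((isSubexp_stat hE k).integrable_law hE h0 hθ).const_mul _
  simp only [dotProduct]
  refine ⟨integrable_finsetSum _ h, ?_⟩
  rw [integral_finsetSum _ h]
  exact Finset.sum_congr rfl fun k _ => integral_const_mul _ _

/-- The integrand is the gap between `exp` and its tangent at the mean `m` of `⟨θ' - θ, φ⟩`. Its
nonnegativity is Jensen's inequality, and its vanishing describes the case of equality. -/
theorem integral_exp_sub_tangent (hE : Measurable E.stat) (h0 : E.base ≠ 0) {θ θ' : ι → ℝ}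
    (hθ : θ ∈ E.paramSet) (hθ' : θ' ∈ E.paramSet) (m : ℝ) (hm : m = (θ' - θ) ⬝ᵥ E.meanMap θ) :
    Integrable (fun x => Real.exp ((θ' - θ) ⬝ᵥ E.stat x) -
      Real.exp m * (1 + ((θ' - θ) ⬝ᵥ E.stat x - m))) (E.law θ) ∧
    ∫ x, (Real.exp ((θ' - θ) ⬝ᵥ E.stat x) -
      Real.exp m * (1 + ((θ' - θ) ⬝ᵥ E.stat x - m))) ∂E.law θ =
        Real.exp (E.logPartition θ' - E.logPartition θ) - Real.exp m := by
  have := isProbabilityMeasure_law hE h0 hθ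
  obtain ⟨hi, hv⟩ := integral_dotProduct_stat hE h0 hθ (θ' - θ)
  have hexp : ∀ x, Real.exp ((θ' - θ) ⬝ᵥ E.stat x) * Real.exp (θ ⬝ᵥ E.stat x) =
      1 * Real.exp (θ' ⬝ᵥ E.stat x) := by
    intro x
    rw [← Real.exp_add, sub_dotProduct, sub_add_cancel, one_mul]
  have h1 : Integrable (fun x => Real.exp ((θ' - θ) ⬝ᵥ E.stat x)) (E.law θ) := by
    rw [integrable_law_iff hE h0 hθ]
    simp_rw [hexp]
    exact (isSubexp_const 1).integrable hE hθ'
  have h2 : ∫ x, Real.exp ((θ' - θ) ⬝ᵥ E.stat x) ∂E.law θ =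
      Real.exp (E.logPartition θ' - E.logPartition θ) := by
    rw [integral_law hE h0 hθ, Real.exp_sub, exp_logPartition hE h0 hθ, exp_logPartition hE h0 hθ']
    congr 1
    simp only [moment]
    simp_rw [hexp]
  have h3 : Integrable (fun x => 1 + ((θ' - θ) ⬝ᵥ E.stat x - m)) (E.law θ) :=
    (integrable_const _).add (hi.sub (integrable_const _))
  have h4 : ∫ x, (1 + ((θ' - θ) ⬝ᵥ E.stat x - m)) ∂E.law θ = 1 := by
    have h5 : Integrable (fun x => (θ' - θ) ⬝ᵥ E.stat x - m) (E.law θ) :=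
      hi.sub (integrable_const _)
    rw [integral_add (integrable_const _) h5, integral_sub hi (integrable_const _), hv, ← hm]
    simp
  refine ⟨h1.sub (h3.const_mul _), ?_⟩
  rw [integral_sub h1 (h3.const_mul _), integral_const_mul, h2, h4, mul_one]

theorem exp_tangent_le (t m : ℝ) : 0 ≤ Real.exp t - Real.exp m * (1 + (t - m)) := by
  have h := Real.add_one_le_exp (t - m)
  have h2 : Real.exp t = Real.exp m * Real.exp (t - m) := by rw [← Real.exp_add]; ring_nf
  rw [h2, ← mul_sub]
  exact mul_nonneg (Real.exp_pos _).le (by linarith)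

/-- Gibbs' inequality: the supremum in the Legendre transform at `Λ(θ)` is attained at `θ`. -/
theorem dotProduct_sub_logPartition_le (hE : Measurable E.stat) (h0 : E.base ≠ 0)
    {θ θ' : ι → ℝ} (hθ : θ ∈ E.paramSet) (hθ' : θ' ∈ E.paramSet) :
    θ' ⬝ᵥ E.meanMap θ - E.logPartition θ' ≤ θ ⬝ᵥ E.meanMap θ - E.logPartition θ := by
  obtain ⟨-, h⟩ := integral_exp_sub_tangent hE h0 hθ hθ' _ rfl
  have h1 : 0 ≤ ∫ x, (Real.exp ((θ' - θ) ⬝ᵥ E.stat x) - Real.exp ((θ' - θ) ⬝ᵥ E.meanMap θ) *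
      (1 + ((θ' - θ) ⬝ᵥ E.stat x - (θ' - θ) ⬝ᵥ E.meanMap θ))) ∂E.law θ :=
    integral_nonneg fun x => exp_tangent_le _ _
  rw [h, sub_nonneg, Real.exp_le_exp, sub_dotProduct] at h1
  linarith

/-- If two parameters have the same mean, Gibbs' inequality in both directions gives equality in
Jensen's inequality. Then `⟨θ' - θ, φ⟩` is almost everywhere constant, so `θ' - θ` lies in the
kernel of an invertible covariance matrix. -/
theorem meanMap_injOn [DecidableEq ι] (hE : Measurable E.stat) (h0 : E.base ≠ 0)
    (hV : ∀ θ ∈ E.paramSet, IsUnit (varMatrix (E.law θ) E.stat)) :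
    Set.InjOn E.meanMap E.paramSet := by
  intro θ hθ θ' hθ' he
  have h1 := dotProduct_sub_logPartition_le hE h0 hθ hθ'
  have h2 := dotProduct_sub_logPartition_le hE h0 hθ' hθ
  rw [← he] at h2
  set m := (θ' - θ) ⬝ᵥ E.meanMap θ with hm
  have hm' : m = E.logPartition θ' - E.logPartition θ := by
    rw [hm, sub_dotProduct]; linarith
  obtain ⟨hi, h⟩ := integral_exp_sub_tangent hE h0 hθ hθ' m hm
  rw [← hm', sub_self, integral_eq_zero_iff_of_nonneg (fun x => exp_tangent_le _ m) hi] at h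
  have hae : ∀ᵐ x ∂E.law θ, (θ' - θ) ⬝ᵥ E.stat x - m = 0 := by
    filter_upwards [h] with x hx
    by_contra hne
    have h3 := Real.add_one_lt_exp hne
    have h4 : Real.exp ((θ' - θ) ⬝ᵥ E.stat x) =
        Real.exp m * Real.exp ((θ' - θ) ⬝ᵥ E.stat x - m) := by rw [← Real.exp_add]; ring_nf
    simp only [Pi.zero_apply] at hx
    rw [h4, ← mul_sub, mul_eq_zero] at hx
    rcases hx with hx | hx
    · exact (Real.exp_pos m).ne' hx
    · linarith
  have hker : varMatrix (E.law θ) E.stat *ᵥ (θ' - θ) = 0 := by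
    funext k
    rw [mulVec_varMatrix_law hE h0 hθ, covariance,
      (integral_dotProduct_stat hE h0 hθ _).2, ← hm]
    refine (integral_congr_ae ?_).trans (integral_zero _ _)
    filter_upwards [hae] with x hx
    rw [hx, mul_zero]
  have hinj := Matrix.mulVec_injective_of_isUnit (hV θ hθ)
  have h5 := hinj (hker.trans (mulVec_zero _).symm)
  exact (sub_eq_zero.1 h5).symm

theorem legendre_meanMap (hE : Measurable E.stat) (h0 : E.base ≠ 0) {θ : ι → ℝ}
    (hθ : θ ∈ E.paramSet) :
    E.legendre (E.meanMap θ) = θ ⬝ᵥ E.meanMap θ - E.logPartition θ := by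
  have : Nonempty E.paramSet := ⟨⟨θ, hθ⟩⟩
  refine le_antisymm (ciSup_le fun θ' => dotProduct_sub_logPartition_le hE h0 hθ θ'.2) ?_
  refine le_ciSup (f := fun θ' : E.paramSet => θ'.1 ⬝ᵥ E.meanMap θ - E.logPartition θ'.1)
    ⟨θ ⬝ᵥ E.meanMap θ - E.logPartition θ, ?_⟩ ⟨θ, hθ⟩
  rintro _ ⟨θ', rfl⟩
  exact dotProduct_sub_logPartition_le hE h0 hθ θ'.2

/-- The inverse function theorem gives a local inverse `g` of `Λ`, and near `Λ(θ)` the supremum is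
attained at `g y`. Hence the gradient of the Legendre transform is `g`, and its Hessian is the
derivative of `g`, the inverse of that of `Λ`. -/
theorem contDiffAt_legendre_and_hessian_eq [DecidableEq ι] (hE : Measurable E.stat)
    (h0 : E.base ≠ 0) {θ : ι → ℝ} (hθ : θ ∈ E.paramSet)
    (hV : IsUnit (varMatrix (E.law θ) E.stat)) :
    ContDiffAt ℝ 2 E.legendre (E.meanMap θ) ∧
      hessian E.legendre (E.meanMap θ) = (varMatrix (E.law θ) E.stat)⁻¹ := by
  set A := varMatrix (E.law θ) E.stat with hA
  have hdet : IsUnit A.det := (Matrix.isUnit_iff_isUnit_det A).1 hV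
  let e : (ι → ℝ) ≃L[ℝ] (ι → ℝ) :=
    (Matrix.toLin'OfInv (Matrix.nonsing_inv_mul A hdet)
      (Matrix.mul_nonsing_inv A hdet)).toContinuousLinearEquiv
  have hΛ : HasFDerivAt E.meanMap (e : (ι → ℝ) →L[ℝ] (ι → ℝ)) θ := by
    refine (hasFDerivAt_meanMap hE h0 hθ).congr_fderiv ?_
    ext1 w
    simp [e, hA, toLin'OfInv]
  have hC : ContDiffAt ℝ 2 E.meanMap θ := contDiffAt_meanMap hE h0 hθ 2
  have hn : (2 : WithTop ℕ∞) ≠ 0 := two_ne_zero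
  have hS := hC.hasStrictFDerivAt' hΛ hn
  set g := hC.localInverse hΛ hn with hg
  have hgC : ContDiffAt ℝ 2 g (E.meanMap θ) := hC.to_localInverse hΛ hn
  have hgθ : g (E.meanMap θ) = θ := hC.localInverse_apply_image hΛ hn
  have hgD : HasFDerivAt g (e.symm : (ι → ℝ) →L[ℝ] (ι → ℝ)) (E.meanMap θ) :=
    hS.to_localInverse.hasFDerivAt
  have hinv : ∀ᶠ y in 𝓝 (E.meanMap θ), E.meanMap (g y) = y := hS.eventually_right_inverse
  have hmem : ∀ᶠ y in 𝓝 (E.meanMap θ), g y ∈ E.paramSet :=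
    hgC.continuousAt.eventually (by rw [hgθ]; exact isOpen_paramSet.mem_nhds hθ)
  have hleg : ∀ᶠ y in 𝓝 (E.meanMap θ),
      E.legendre y = dotCLM ι (g y) y - E.logPartition (g y) := by
    filter_upwards [hinv, hmem] with y h1 h2
    have := legendre_meanMap hE h0 h2
    rw [h1] at this
    rw [this, dotCLM_apply]
  have hdiff : ∀ᶠ y in 𝓝 (E.meanMap θ), DifferentiableAt ℝ g y := by
    filter_upwards [hgC.eventually (by simp)] with y hy
    exact hy.differentiableAt two_ne_zero
  have hfd : fderiv ℝ E.legendre =ᶠ[𝓝 (E.meanMap θ)] fun y => dotCLM ι (g y) := by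
    filter_upwards [hleg.eventually_nhds, hdiff, hinv, hmem] with y h1 h2 h3 h4
    have h5 : HasFDerivAt (fun y => dotCLM ι (g y) y) _ y :=
      ((dotCLM ι).hasFDerivAt.comp y h2.hasFDerivAt).clm_apply (hasFDerivAt_id y)
    have h6 := (hasFDerivAt_logPartition hE h0 h4).comp y h2.hasFDerivAt
    have h7 : HasFDerivAt (fun y => dotCLM ι (g y) y - E.logPartition (g y)) _ y := h5.sub h6
    -- The two terms with the derivative of `g` cancel, since the gradient of `ψ` at `g y` is `Λ(g
    -- y) = y`.
    rw [Filter.EventuallyEq.fderiv_eq h1, h7.fderiv]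
    ext1 w
    simp [dotCLM_apply, h3, dotProduct_comm]
  refine ⟨?_, ?_⟩
  · have h7 : ContDiffAt ℝ 2 (fun y => dotCLM ι (g y) y - E.logPartition (g y)) (E.meanMap θ) := by
      refine (((dotCLM ι).contDiff.contDiffAt.comp _ hgC).clm_apply contDiffAt_id).sub ?_
      have h8 : ContDiffAt ℝ 2 E.logPartition (g (E.meanMap θ)) := by
        rw [hgθ]
        exact contDiffAt_logPartition hE h0 hθ 2
      exact h8.comp _ hgC
    exact h7.congr_of_eventuallyEq hleg
  · ext a b
    rw [hessian, Matrix.of_apply, hfd.fderiv_eq]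
    change (fderiv ℝ (dotCLM ι ∘ g) (E.meanMap θ)) _ _ = _
    rw [((dotCLM ι).hasFDerivAt.comp _ hgD).fderiv, ContinuousLinearMap.comp_apply, dotCLM_apply]
    have hsymm : (A⁻¹)ᵀ = A⁻¹ := by
      rw [Matrix.transpose_nonsing_inv, (isSymm_varMatrix (E.law θ) E.stat).eq]
    have h8 : (e.symm : (ι → ℝ) →L[ℝ] (ι → ℝ)) (Pi.single a 1) = A⁻¹ *ᵥ Pi.single a 1 := by
      simp [e, toLin'OfInv]
    rw [h8, dotProduct_single, mul_one, mulVec_single_one]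
    exact congrFun (congrFun hsymm a) b

end ExpFamily

/-! ### Block matrices -/

namespace Matrix

section BlockDiagonal

variable {o : Type*} [Fintype o] [DecidableEq o] {m : o → Type*} [∀ i, Fintype (m i)]
  {R : Type*} [CommRing R]

theorem blockDiagonal'_mul_apply {κ : Type*} (M : (i : o) → Matrix (m i) (m i) R)
    (B : Matrix (Σ i, m i) κ R) (i : o) (k : m i) (b : κ) :
    (blockDiagonal' M * B) ⟨i, k⟩ b = ∑ l, M i k l * B ⟨i, l⟩ b := by
  rw [mul_apply, Fintype.sum_sigma, Finset.sum_eq_single i]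
  · simp only [blockDiagonal'_apply_eq]
  · intro j _ hj
    refine Finset.sum_eq_zero fun l _ => ?_
    rw [blockDiagonal'_apply_ne M k l hj.symm, zero_mul]
  · simp

theorem transpose_mul_blockDiagonal'_mul {κ : Type*} (M : (i : o) → Matrix (m i) (m i) R)
    (B : Matrix (Σ i, m i) κ R) :
    Bᵀ * blockDiagonal' M * B =
      ∑ i, (B.submatrix (Sigma.mk i) id)ᵀ * M i * B.submatrix (Sigma.mk i) id := by
  ext a b
  rw [Matrix.sum_apply, Matrix.mul_assoc, mul_apply, Fintype.sum_sigma]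
  refine Finset.sum_congr rfl fun i _ => ?_
  rw [Matrix.mul_assoc, mul_apply]
  refine Finset.sum_congr rfl fun k _ => ?_
  rw [blockDiagonal'_mul_apply, mul_apply]
  rfl

variable [∀ i, DecidableEq (m i)]

theorem det_blockDiagonal' (M : (i : o) → Matrix (m i) (m i) R) :
    (blockDiagonal' M).det = ∏ i, (M i).det := by
  let b : (Σ i, m i) → Fin (Fintype.card o) := fun s => Fintype.equivFin o s.1
  have hb : (blockDiagonal' M).BlockTriangular b := by
    rintro ⟨i, k⟩ ⟨j, l⟩ h
    refine blockDiagonal'_apply_ne M k l fun hij => ?_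
    subst hij
    exact lt_irrefl _ h
  rw [hb.det_fintype, ← (Fintype.equivFin o).prod_comp]
  refine Finset.prod_congr rfl fun i _ => ?_
  let e : m i ≃ {s : Σ i, m i // b s = Fintype.equivFin o i} :=
    { toFun := fun k => ⟨⟨i, k⟩, rfl⟩
      invFun := fun s => cast (by rw [(Fintype.equivFin o).injective s.2]) s.1.2
      left_inv := fun k => rfl
      right_inv := by
        rintro ⟨⟨j, k⟩, h⟩
        obtain rfl := (Fintype.equivFin o).injective h
        rfl }
  rw [← det_submatrix_equiv_self e]
  congr 1
  ext k l
  exact blockDiagonal'_apply_eq M i k l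

theorem inv_blockDiagonal' (M : (i : o) → Matrix (m i) (m i) R) (hM : ∀ i, IsUnit (M i).det) :
    (blockDiagonal' M)⁻¹ = blockDiagonal' fun i => (M i)⁻¹ := by
  refine inv_eq_right_inv ?_
  rw [← blockDiagonal'_mul, ← blockDiagonal'_one]
  congr 1
  funext i
  exact mul_nonsing_inv _ (hM i)

end BlockDiagonal

/-- The determinant identity behind the Bethe-zeta formula. -/
theorem det_transpose_mul_inv_mul_add {F W U K : Type*} [Field K] [Fintype F] [DecidableEq F]
    [Fintype W] [DecidableEq W] [Fintype U] [DecidableEq U] (N : Matrix W U K)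
    (A : Matrix (F ⊕ W) (F ⊕ W) K) (DW : Matrix W W K) (DU C : Matrix U U K)
    (hA : IsUnit A.det) (hDW : IsUnit DW.det) (hDU : IsUnit DU.det) (hN : N * DU = DW * N)
    (hC : Nᵀ * N + C = 1) :
    ((fromBlocks (1 : Matrix F F K) 0 0 N)ᵀ * A⁻¹ * fromBlocks (1 : Matrix F F K) 0 0 N +
        fromBlocks 0 0 0 (C * DU⁻¹)).det * DU.det * A.det =
      DW.det * (1 - (DW⁻¹ * A.toBlocks₂₂ - 1) * (N * Nᵀ - 1)).det := by
  -- All matrices are extended by an identity block on `F`, so that they match the size of `A`.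
  set N' := fromBlocks (1 : Matrix F F K) 0 0 N with hN'
  set DW' := fromBlocks (1 : Matrix F F K) 0 0 DW with hDW'
  set DU' := fromBlocks (1 : Matrix F F K) 0 0 DU with hDU'
  have h1 : N' * DU' = DW' * N' := by
    simp [hN', hDU', hDW', fromBlocks_multiply, hN]
  have h2 : DU'.det = DU.det := by simp [hDU']
  have h3 : fromBlocks 0 0 0 (C * DU⁻¹) * DU' = 1 - N'ᵀ * N' := by
    rw [← eq_sub_iff_add_eq'] at hC
    rw [← fromBlocks_one, hN', hDU', fromBlocks_transpose, fromBlocks_multiply,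
      fromBlocks_multiply, sub_eq_add_neg, fromBlocks_neg, fromBlocks_add]
    rw [Matrix.mul_assoc C DU⁻¹ DU, nonsing_inv_mul _ hDU, hC]
    simp [sub_eq_add_neg]
  -- Multiplying by `DU'` clears its inverse in the second summand, while `N' * DU' = DW' * N'`
  -- moves it past `N'` in the first. The result has the form `1 + XY` needed for Sylvester's
  -- identity.
  have h4 : (N'ᵀ * A⁻¹ * N' + fromBlocks 0 0 0 (C * DU⁻¹)) * DU' =
      1 + N'ᵀ * ((A⁻¹ * DW' - 1) * N') := by
    rw [Matrix.add_mul, h3, Matrix.mul_assoc _ N' DU', h1]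
    simp only [Matrix.sub_mul, Matrix.mul_sub, Matrix.mul_assoc, Matrix.one_mul]
    abel
  have h5 : A * (1 + (A⁻¹ * DW' - 1) * N' * N'ᵀ) = DW' + (DW' - A) * (N' * N'ᵀ - 1) := by
    rw [Matrix.mul_add, Matrix.mul_one, Matrix.mul_assoc _ N' N'ᵀ, ← Matrix.mul_assoc A,
      Matrix.mul_sub A, ← Matrix.mul_assoc A, mul_nonsing_inv _ hA, Matrix.one_mul, Matrix.mul_one,
      Matrix.mul_sub, Matrix.mul_one]
    abel
  have h6 : N' * N'ᵀ - 1 = fromBlocks 0 0 0 (N * Nᵀ - 1) := by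
    rw [← fromBlocks_one, hN', fromBlocks_transpose, fromBlocks_multiply, sub_eq_add_neg,
      fromBlocks_neg, fromBlocks_add]
    simp [sub_eq_add_neg]
  -- As `N' * N'ᵀ - 1` lives in the lower right block, only the right column changes. The matrix is
  -- block triangular with identity block on `F`.
  have h7 : DW' + (DW' - A) * (N' * N'ᵀ - 1) =
      fromBlocks 1 (-(A.toBlocks₁₂ * (N * Nᵀ - 1))) 0
        (DW * (1 - (DW⁻¹ * A.toBlocks₂₂ - 1) * (N * Nᵀ - 1))) := by
    have h8 : DW * (1 - (DW⁻¹ * A.toBlocks₂₂ - 1) * (N * Nᵀ - 1)) =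
        DW + (DW - A.toBlocks₂₂) * (N * Nᵀ - 1) := by
      rw [Matrix.mul_sub, Matrix.mul_one, ← Matrix.mul_assoc, Matrix.mul_sub DW,
        ← Matrix.mul_assoc DW, mul_nonsing_inv _ hDW, Matrix.one_mul, Matrix.mul_one,
        ← neg_sub A.toBlocks₂₂ DW, Matrix.neg_mul, sub_eq_add_neg]
    rw [h6, h8, hDW']
    conv_lhs => rw [← fromBlocks_toBlocks A]
    rw [sub_eq_add_neg, fromBlocks_neg, fromBlocks_add, fromBlocks_multiply, fromBlocks_add]
    simp [sub_eq_add_neg]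
  calc _ = ((N'ᵀ * A⁻¹ * N' + fromBlocks 0 0 0 (C * DU⁻¹)) * DU').det * A.det := by
        rw [det_mul, h2]
    _ = (A * (1 + (A⁻¹ * DW' - 1) * N' * N'ᵀ)).det := by
        rw [h4, det_one_add_mul_comm, det_mul, mul_comm]
    _ = _ := by
        rw [h5, h7, det_fromBlocks_zero₂₁, det_one, one_mul, det_mul]

end Matrix

/-! ### Calculus of Hessians -/

section Hessian

variable {κ l : Type*} [Fintype κ] [DecidableEq κ] [Fintype l] [DecidableEq l]

theorem hessian_add {f g : (κ → ℝ) → ℝ} {x : κ → ℝ} (hf : ContDiffAt ℝ 2 f x)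
    (hg : ContDiffAt ℝ 2 g x) :
    hessian (fun y => f y + g y) x = hessian f x + hessian g x := by
  have h1 : fderiv ℝ (fun y => f y + g y) =ᶠ[𝓝 x] fun y => fderiv ℝ f y + fderiv ℝ g y := by
    filter_upwards [hf.eventually (by simp), hg.eventually (by simp)] with y h1 h2
    exact fderiv_fun_add (h1.differentiableAt two_ne_zero) (h2.differentiableAt two_ne_zero)
  have hf' : DifferentiableAt ℝ (fderiv ℝ f) x :=
    (hf.fderiv_right (m := 1) (by norm_num)).differentiableAt one_ne_zero
  have hg' : DifferentiableAt ℝ (fderiv ℝ g) x :=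
    (hg.fderiv_right (m := 1) (by norm_num)).differentiableAt one_ne_zero
  ext a b
  simp only [hessian, Matrix.of_apply, Matrix.add_apply]
  rw [h1.fderiv_eq, fderiv_fun_add hf' hg']
  rfl

theorem hessian_const_mul {f : (κ → ℝ) → ℝ} {x : κ → ℝ} (c : ℝ) (hf : ContDiffAt ℝ 2 f x) :
    hessian (fun y => c * f y) x = c • hessian f x := by
  have h1 : fderiv ℝ (fun y => c * f y) =ᶠ[𝓝 x] fun y => c • fderiv ℝ f y := by
    filter_upwards [hf.eventually (by simp)] with y h1
    exact fderiv_const_mul (h1.differentiableAt two_ne_zero) c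
  have hf' : DifferentiableAt ℝ (fderiv ℝ f) x :=
    (hf.fderiv_right (m := 1) (by norm_num)).differentiableAt one_ne_zero
  ext a b
  simp only [hessian, Matrix.of_apply, Matrix.smul_apply]
  rw [h1.fderiv_eq, fderiv_fun_const_smul hf' c]
  rfl

theorem hessian_sum {o : Type*} (s : Finset o) {f : o → (κ → ℝ) → ℝ} {x : κ → ℝ}
    (hf : ∀ i ∈ s, ContDiffAt ℝ 2 (f i) x) :
    hessian (fun y => ∑ i ∈ s, f i y) x = ∑ i ∈ s, hessian (f i) x := by
  classical
  induction s using Finset.induction with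
  | empty =>
    ext a b
    simp [hessian]
  | insert i s hi ih =>
    simp only [Finset.sum_insert hi]
    rw [hessian_add (hf i (Finset.mem_insert_self i s))
      (ContDiffAt.sum fun j hj => hf j (Finset.mem_insert_of_mem hj)),
      ih fun j hj => hf j (Finset.mem_insert_of_mem hj)]

theorem fderiv_fderiv_comp_clm {E G : Type*} [NormedAddCommGroup E] [NormedSpace ℝ E]
    [NormedAddCommGroup G] [NormedSpace ℝ G] (P : E →L[ℝ] G) {f : G → ℝ} {x : E}
    (hf : ContDiffAt ℝ 2 f (P x)) (v w : E) :
    fderiv ℝ (fderiv ℝ fun y => f (P y)) x v w = fderiv ℝ (fderiv ℝ f) (P x) (P v) (P w) := by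
  have hev : ∀ᶠ y in 𝓝 x, ContDiffAt ℝ 2 f (P y) :=
    P.continuous.continuousAt.eventually (hf.eventually (by simp))
  have h1 : fderiv ℝ (fun y => f (P y)) =ᶠ[𝓝 x] fun y => P.precomp ℝ (fderiv ℝ f (P y)) := by
    filter_upwards [hev] with y hy
    exact ((hy.differentiableAt two_ne_zero).hasFDerivAt.comp y P.hasFDerivAt).fderiv
  have hf' : HasFDerivAt (fderiv ℝ f) (fderiv ℝ (fderiv ℝ f) (P x)) (P x) :=
    ((hf.fderiv_right (m := 1) (by norm_num)).differentiableAt one_ne_zero).hasFDerivAt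
  have h2 : HasFDerivAt (fun y => P.precomp ℝ (fderiv ℝ f (P y))) _ x :=
    (P.precomp ℝ).hasFDerivAt.comp x (hf'.comp x P.hasFDerivAt)
  rw [h1.fderiv_eq, h2.fderiv]
  rfl

/-- The coordinate selection `y ↦ y ∘ σ` as a continuous linear map. -/
noncomputable def selectCLM (σ : l → κ) : (κ → ℝ) →L[ℝ] (l → ℝ) :=
  ContinuousLinearMap.pi fun k => ContinuousLinearMap.proj (σ k)

theorem hessian_comp_select (σ : l → κ) {f : (l → ℝ) → ℝ} {x : κ → ℝ}
    (hf : ContDiffAt ℝ 2 f (x ∘ σ)) :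
    hessian (fun y => f (y ∘ σ)) x =
      ((1 : Matrix κ κ ℝ).submatrix σ id)ᵀ * hessian f (x ∘ σ) *
        (1 : Matrix κ κ ℝ).submatrix σ id := by
  have hP : ∀ y : κ → ℝ, selectCLM σ y = y ∘ σ := fun y => rfl
  have hsel : ∀ a : κ, selectCLM σ (Pi.single a 1) =
      ∑ k, (1 : Matrix κ κ ℝ) (σ k) a • (Pi.single k 1 : l → ℝ) := by
    intro a
    rw [hP]
    funext k
    rw [Finset.sum_apply]
    simp only [Pi.smul_apply, Pi.single_apply, smul_eq_mul, mul_ite, mul_one, mul_zero,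
      Finset.sum_ite_eq, Finset.mem_univ, if_true, Function.comp, Matrix.one_apply]
  ext a b
  rw [hessian, Matrix.of_apply]
  refine (fderiv_fderiv_comp_clm (selectCLM σ) (x := x) hf _ _).trans ?_
  rw [hsel, hsel, Matrix.mul_assoc, Matrix.mul_apply]
  simp only [map_sum, map_smul, _root_.sum_apply, _root_.smul_apply, Matrix.mul_apply,
    Matrix.transpose_apply, Matrix.submatrix_apply, hessian, Matrix.of_apply, smul_eq_mul,
    Finset.mul_sum]
  rw [Finset.sum_comm]
  refine Finset.sum_congr rfl fun k _ => Finset.sum_congr rfl fun j _ => ?_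
  rw [hP]
  change (1 : Matrix κ κ ℝ) (σ j) b * ((1 : Matrix κ κ ℝ) (σ k) a * _) =
    (1 : Matrix κ κ ℝ) (σ k) a * (_ * (1 : Matrix κ κ ℝ) (σ j) b)
  ring

theorem hessian_continuousLinearMap (φ : (κ → ℝ) →L[ℝ] ℝ) (x : κ → ℝ) : hessian φ x = 0 := by
  have : fderiv ℝ φ = fun _ => φ := funext fun y => φ.fderiv
  ext a b
  simp [hessian, this]

end Hessian

/-! ### Inference families -/

namespace InferenceFamily

variable {V : Type*} [DecidableEq V] {H : FinHypergraph V} {X : V → Type*}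
  [∀ i, MeasurableSpace (X i)] (I : InferenceFamily H X)

theorem measurable_vertexFamily_stat (i : V) : Measurable (I.vertexFamily i).stat :=
  I.measurable_statV i

theorem measurable_factorFamily_stat (α : H.Factor) : Measurable (I.factorFamily α).stat := by
  refine measurable_pi_iff.2 ?_
  rintro (k | k)
  · exact (measurable_pi_apply k).comp (I.measurable_statF α)
  · exact (measurable_pi_apply k.2).comp ((I.measurable_statV k.1).comp (measurable_pi_apply k.1))

theorem vertexFamily_base_ne_zero (i : V) : (I.vertexFamily i).base ≠ 0 := I.base_ne_zero i

theorem factorFamily_base_ne_zero (α : H.Factor) : (I.factorFamily α).base ≠ 0 := by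
  have := I.sigmaFinite_base
  intro h
  have h1 : Measure.pi (fun i : {i : V // i ∈ α.1} => I.base i) Set.univ = 0 := by
    change (I.factorFamily α).base Set.univ = 0
    rw [h]; rfl
  rw [Measure.pi_univ, Finset.prod_eq_zero_iff] at h1
  obtain ⟨i, -, hi⟩ := h1
  exact I.base_ne_zero i (Measure.measure_univ_eq_zero.1 hi)

variable {I}

theorem isUnit_varMatrix_vertex (i : V) {θ} (hθ : θ ∈ (I.vertexFamily i).paramSet) :
    IsUnit (varMatrix ((I.vertexFamily i).law θ) (I.vertexFamily i).stat) := by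
  rw [← ExpFamily.hessian_logPartition (I.measurable_vertexFamily_stat i)
    (I.vertexFamily_base_ne_zero i) hθ]
  exact I.hessian_vertex_invertible i θ hθ

theorem isUnit_varMatrix_factor (α : H.Factor) {θ} (hθ : θ ∈ (I.factorFamily α).paramSet) :
    IsUnit (varMatrix ((I.factorFamily α).law θ) (I.factorFamily α).stat) := by
  rw [← ExpFamily.hessian_logPartition (I.measurable_factorFamily_stat α)
    (I.factorFamily_base_ne_zero α) hθ]
  exact I.hessian_factor_invertible α θ hθ

variable {η : I.Coord → ℝ}

theorem vertex_param_spec (hη : η ∈ I.localSet) (i : V) :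
    Function.invFunOn (I.vertexFamily i).meanMap (I.vertexFamily i).paramSet (I.vertexPart η i) ∈
        (I.vertexFamily i).paramSet ∧
      (I.vertexFamily i).meanMap (Function.invFunOn (I.vertexFamily i).meanMap
        (I.vertexFamily i).paramSet (I.vertexPart η i)) = I.vertexPart η i :=
  ⟨Function.invFunOn_mem (hη.2 i), Function.invFunOn_eq (hη.2 i)⟩

theorem factor_param_spec (hη : η ∈ I.localSet) (α : H.Factor) :
    Function.invFunOn (I.factorFamily α).meanMap (I.factorFamily α).paramSet (I.factorPart η α) ∈
        (I.factorFamily α).paramSet ∧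
      (I.factorFamily α).meanMap (Function.invFunOn (I.factorFamily α).meanMap
        (I.factorFamily α).paramSet (I.factorPart η α)) = I.factorPart η α :=
  ⟨Function.invFunOn_mem (hη.1 α), Function.invFunOn_eq (hη.1 α)⟩

theorem isUnit_det_vertexVar (hη : η ∈ I.localSet) (i : V) : IsUnit (I.vertexVar η i).det :=
  (Matrix.isUnit_iff_isUnit_det _).1 (isUnit_varMatrix_vertex i (vertex_param_spec hη i).1)

theorem isUnit_det_factorVar (hη : η ∈ I.localSet) (α : H.Factor) :
    IsUnit (I.factorVar η α).det :=
  (Matrix.isUnit_iff_isUnit_det _).1 (isUnit_varMatrix_factor α (factor_param_spec hη α).1)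

theorem legendre_vertex (hη : η ∈ I.localSet) (i : V) :
    ContDiffAt ℝ 2 (I.vertexFamily i).legendre (I.vertexPart η i) ∧
      hessian (I.vertexFamily i).legendre (I.vertexPart η i) = (I.vertexVar η i)⁻¹ := by
  have h := ExpFamily.contDiffAt_legendre_and_hessian_eq (I.measurable_vertexFamily_stat i)
    (I.vertexFamily_base_ne_zero i) (vertex_param_spec hη i).1
    (isUnit_varMatrix_vertex i (vertex_param_spec hη i).1)
  rw [(vertex_param_spec hη i).2] at h
  exact h

theorem legendre_factor (hη : η ∈ I.localSet) (α : H.Factor) :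
    ContDiffAt ℝ 2 (I.factorFamily α).legendre (I.factorPart η α) ∧
      hessian (I.factorFamily α).legendre (I.factorPart η α) = (I.factorVar η α)⁻¹ := by
  have h := ExpFamily.contDiffAt_legendre_and_hessian_eq (I.measurable_factorFamily_stat α)
    (I.factorFamily_base_ne_zero α) (factor_param_spec hη α).1
    (isUnit_varMatrix_factor α (factor_param_spec hη α).1)
  rw [(factor_param_spec hη α).2] at h
  exact h

/-- The marginal of `b_α` on `X_i` is `b_i`. -/
theorem map_factorBelief (hη : η ∈ I.localSet) (α : H.Factor) (i : {i : V // i ∈ α.1}) :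
    (I.factorBelief η α).map (fun x => x i) = I.vertexBelief η i := by
  obtain ⟨hθ, hm⟩ := factor_param_spec hη α
  obtain ⟨hθi, hmi⟩ := vertex_param_spec hη i
  obtain ⟨θ', hθ', hlaw⟩ := I.marginally_closed α i _ hθ
  -- Marginal closure provides some member of `E_i`. Its mean is read off from `b_α`, and
  -- injectivity of `Λ_i` identifies its parameter with the one selected in `b_i`.
  have hmean : (I.vertexFamily i).meanMap θ' = I.vertexPart η i := by
    funext k
    rw [ExpFamily.meanMap, ← hlaw, integral_map (measurable_pi_apply i).aemeasurable]
    · exact congrFun hm (Sum.inr ⟨i, k⟩)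
    · exact ((measurable_pi_apply k).comp (I.measurable_statV i)).aestronglyMeasurable
  have hinj := ExpFamily.meanMap_injOn (I.measurable_vertexFamily_stat i)
    (I.vertexFamily_base_ne_zero i) (fun θ hθ => isUnit_varMatrix_vertex i.1 hθ)
  have h := hinj hθ' hθi (hmean.trans hmi.symm)
  rw [h] at hlaw
  exact hlaw

/-- The covariance of `φ_i` under `b_α` depends only on the marginal `b_i`. This is what makes the
diagonal blocks of `D_W⁻¹ A₂₂ - 1` vanish. -/
theorem factorVar_diag (hη : η ∈ I.localSet) (α : H.Factor) (i : {i : V // i ∈ α.1})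
    (k l : Fin (I.dimV i)) :
    I.factorVar η α (.inr ⟨i, k⟩) (.inr ⟨i, l⟩) = I.vertexVar η i k l := by
  have hm : ∀ k, Measurable fun y => I.statV i y k := fun k =>
    (measurable_pi_apply k).comp (I.measurable_statV i)
  rw [vertexVar, ← map_factorBelief hη α i, varMatrix, covMatrix, Matrix.of_apply,
    covariance_map_fun (hm k).aestronglyMeasurable (hm l).aestronglyMeasurable
      (measurable_pi_apply i).aemeasurable]
  rfl

/-! ### The determinant of `I - M(u)` -/

variable (I)

/-- Components of the statistics of the factors, split into additional and vertex statistics. -/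
def factorIdxEquiv : (Σ α : H.Factor, I.FactorIdx α) ≃
    (Σ α : H.Factor, Fin (I.dimF α)) ⊕ (Σ e : H.DirEdge, Fin (I.edgeDim e)) where
  toFun := fun s => match s with
    | ⟨α, .inl k⟩ => .inl ⟨α, k⟩
    | ⟨α, .inr k⟩ => .inr ⟨⟨α, k.1⟩, k.2⟩
  invFun := fun s => match s with
    | .inl s => ⟨s.1, .inl s.2⟩
    | .inr s => ⟨s.1.1, .inr ⟨s.1.2, s.2⟩⟩
  left_inv := by rintro ⟨α, k | k⟩ <;> rfl
  right_inv := by rintro (s | s) <;> rfl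

/-- The vertex component of a component of a directed edge. -/
def tgtIdx (s : Σ e : H.DirEdge, Fin (I.edgeDim e)) : Σ i : V, Fin (I.dimV i) :=
  ⟨FinHypergraph.tgt s.1, s.2⟩

theorem tgtIdx_eq_iff (e : H.DirEdge) (k l : Fin (I.edgeDim e)) :
    I.tgtIdx ⟨e, k⟩ = ⟨FinHypergraph.tgt e, l⟩ ↔ k = l :=
  ⟨fun h => eq_of_heq (Sigma.mk.inj_iff.1 (show (⟨FinHypergraph.tgt e, k⟩ :
    Σ i : V, Fin (I.dimV i)) = ⟨FinHypergraph.tgt e, l⟩ from h)).2, fun h => h ▸ rfl⟩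

/-- The incidence matrix of directed edges and their termini. -/
noncomputable def incidence :
    Matrix (Σ e : H.DirEdge, Fin (I.edgeDim e)) (Σ i : V, Fin (I.dimV i)) ℝ :=
  (1 : Matrix (Σ i : V, Fin (I.dimV i)) (Σ i : V, Fin (I.dimV i)) ℝ).submatrix I.tgtIdx id

/-- The block diagonal matrix of the `Var_{b_α}(φ_α)`. -/
noncomputable def allFactorVar (η : I.Coord → ℝ) :
    Matrix ((Σ α : H.Factor, Fin (I.dimF α)) ⊕ (Σ e : H.DirEdge, Fin (I.edgeDim e)))
      ((Σ α : H.Factor, Fin (I.dimF α)) ⊕ (Σ e : H.DirEdge, Fin (I.edgeDim e))) ℝ :=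
  (blockDiagonal' (I.factorVar η)).submatrix I.factorIdxEquiv.symm I.factorIdxEquiv.symm

/-- The block diagonal matrix of the `Var_{b_i}(φ_i)` over the directed edges `α → i`. -/
noncomputable def edgeVar (η : I.Coord → ℝ) :
    Matrix (Σ e : H.DirEdge, Fin (I.edgeDim e)) (Σ e : H.DirEdge, Fin (I.edgeDim e)) ℝ :=
  blockDiagonal' fun e : H.DirEdge => I.vertexVar η (FinHypergraph.tgt e)

theorem card_tgt_eq (i : V) :
    (Finset.univ.filter fun e : H.DirEdge => FinHypergraph.tgt e = i).card = H.degree i := by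
  refine Finset.card_bij (fun e _ => e.1.1) ?_ ?_ ?_
  · rintro ⟨α, j, hj⟩ h
    simp only [Finset.mem_filter, Finset.mem_univ, true_and] at h
    subst h
    exact Finset.mem_filter.2 ⟨α.2, hj⟩
  · rintro ⟨⟨α, hα⟩, j, hj⟩ h ⟨⟨β, hβ⟩, j', hj'⟩ h' he
    simp only [Finset.mem_filter, Finset.mem_univ, true_and] at h h' he
    subst he
    subst h
    subst h'
    rfl
  · intro α hα
    obtain ⟨h1, h2⟩ := Finset.mem_filter.1 hα
    exact ⟨⟨⟨α, h1⟩, ⟨i, h2⟩⟩, by simp, rfl⟩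

theorem incidence_apply (w : Σ e : H.DirEdge, Fin (I.edgeDim e)) (u : Σ i : V, Fin (I.dimV i)) :
    I.incidence w u = if I.tgtIdx w = u then 1 else 0 := by
  rw [incidence, Matrix.submatrix_apply, Matrix.one_apply]
  rfl

/-- Every edge into `i` carries the same matrix `Var_{b_i}(φ_i)`, so the incidence matrix
intertwines the two block diagonals. -/
theorem incidence_mul_blockDiagonal' [Fintype V] (η : I.Coord → ℝ) :
    I.incidence * blockDiagonal' (I.vertexVar η) = I.edgeVar η * I.incidence := by
  ext ⟨e, k⟩ ⟨j, l⟩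
  rw [edgeVar, blockDiagonal'_mul_apply, Matrix.mul_apply,
    Finset.sum_eq_single (I.tgtIdx ⟨e, k⟩), incidence_apply, if_pos rfl, one_mul]
  · change blockDiagonal' (I.vertexVar η) ⟨FinHypergraph.tgt e, k⟩ ⟨j, l⟩ = _
    by_cases h : FinHypergraph.tgt e = j
    · subst h
      rw [blockDiagonal'_apply_eq, Finset.sum_eq_single l, incidence_apply,
        if_pos ((I.tgtIdx_eq_iff e l l).2 rfl), mul_one]
      · intro m _ hm
        rw [incidence_apply, if_neg, mul_zero]
        exact fun h => hm ((I.tgtIdx_eq_iff e m l).1 h)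
      · simp
    · rw [blockDiagonal'_apply_ne _ _ _ h]
      refine (Finset.sum_eq_zero fun m _ => ?_).symm
      rw [incidence_apply, if_neg, mul_zero]
      exact fun hm => h (congrArg Sigma.fst hm)
  · intro u _ hu
    rw [incidence_apply, if_neg hu.symm, zero_mul]
  · simp

theorem transpose_incidence_mul :
    I.incidenceᵀ * I.incidence = Matrix.diagonal fun u => (H.degree u.1 : ℝ) := by
  ext ⟨i, k⟩ u
  rw [Matrix.mul_apply, Matrix.diagonal_apply]
  simp only [Matrix.transpose_apply, incidence_apply, mul_ite, mul_one, mul_zero]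
  split_ifs with h
  · subst h
    rw [← card_tgt_eq, Finset.card_filter, Fintype.sum_sigma]
    push_cast
    refine Finset.sum_congr rfl fun e _ => ?_
    split_ifs with he
    · subst he
      rw [Finset.sum_eq_single k]
      · exact if_pos ((I.tgtIdx_eq_iff e k k).2 rfl)
      · intro m _ hm
        exact if_neg fun h => hm ((I.tgtIdx_eq_iff e m k).1 h)
      · simp
    · exact Finset.sum_eq_zero fun m _ => if_neg fun hm => he (congrArg Sigma.fst hm)
  · refine Finset.sum_eq_zero fun w _ => ?_
    split_ifs with h1 h2
    · exact absurd (h2.symm.trans h1) h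
    · rfl
    · rfl

variable {I}

theorem edgeVar_inv_mul_apply (hη : η ∈ I.localSet) (e e' : H.DirEdge) (k : Fin (I.edgeDim e))
    (l : Fin (I.edgeDim e')) :
    ((I.edgeVar η)⁻¹ * (I.allFactorVar η).toBlocks₂₂) ⟨e, k⟩ ⟨e', l⟩ =
      ∑ m, (I.vertexVar η (FinHypergraph.tgt e))⁻¹ k m * blockDiagonal' (I.factorVar η)
        ⟨e.1, .inr ⟨e.2, m⟩⟩ ⟨e'.1, .inr ⟨e'.2, l⟩⟩ := by
  rw [edgeVar, inv_blockDiagonal' _ fun e => isUnit_det_vertexVar hη _, blockDiagonal'_mul_apply]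
  rfl

theorem edgeVar_inv_mul_sub_one_of_src_ne (hη : η ∈ I.localSet) {e e' : H.DirEdge}
    (h : e.1 ≠ e'.1) (k : Fin (I.edgeDim e)) (l : Fin (I.edgeDim e')) :
    ((I.edgeVar η)⁻¹ * (I.allFactorVar η).toBlocks₂₂ - 1) ⟨e, k⟩ ⟨e', l⟩ = 0 := by
  rw [Matrix.sub_apply, edgeVar_inv_mul_apply hη, Matrix.one_apply_ne, sub_zero]
  · refine Finset.sum_eq_zero fun m _ => ?_
    rw [blockDiagonal'_apply_ne _ _ _ h, mul_zero]
  · intro he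
    exact h (congrArg (fun s : Σ e : H.DirEdge, Fin (I.edgeDim e) => s.1.1) he)

theorem edgeVar_inv_mul_sub_one_of_eq (hη : η ∈ I.localSet) (e : H.DirEdge)
    (k l : Fin (I.edgeDim e)) :
    ((I.edgeVar η)⁻¹ * (I.allFactorVar η).toBlocks₂₂ - 1) ⟨e, k⟩ ⟨e, l⟩ = 0 := by
  rw [Matrix.sub_apply, edgeVar_inv_mul_apply hη]
  simp only [blockDiagonal'_apply_eq, factorVar_diag hη]
  rw [← Matrix.mul_apply, Matrix.nonsing_inv_mul _ (isUnit_det_vertexVar hη _)]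
  simp [Matrix.one_apply]

theorem edgeVar_inv_mul_sub_one_of_ne (hη : η ∈ I.localSet) (α : H.Factor)
    {i j : {i : V // i ∈ α.1}} (h : i ≠ j) (k : Fin (I.dimV i)) (l : Fin (I.dimV j)) :
    ((I.edgeVar η)⁻¹ * (I.allFactorVar η).toBlocks₂₂ - 1) ⟨⟨α, i⟩, k⟩ ⟨⟨α, j⟩, l⟩ =
      I.factorWeight η α j i k l := by
  rw [Matrix.sub_apply, edgeVar_inv_mul_apply hη, Matrix.one_apply_ne, sub_zero]
  · simp only [blockDiagonal'_apply_eq]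
    rw [factorWeight, Matrix.mul_apply]
    rfl
  · intro he
    have := congrArg Sigma.fst he
    simp only [Sigma.mk.injEq, heq_eq_eq, true_and] at this
    exact h this

/-- A step `e' ⇀ e` splits in two: at the vertex `j = t(e')` pass to another factor `α`, then inside
`α` pass from `j` to another vertex. The matrix `NNᵀ - 1` forbids keeping the factor, the zero
diagonal blocks of `K` forbid keeping the vertex. -/
theorem edgeMatrix_weight [Fintype V] (hη : η ∈ I.localSet) :
    (I.weight η).edgeMatrix =
      (((I.edgeVar η)⁻¹ * (I.allFactorVar η).toBlocks₂₂ - 1) *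
        (I.incidence * I.incidenceᵀ - 1)).map Complex.ofReal := by
  set K := (I.edgeVar η)⁻¹ * (I.allFactorVar η).toBlocks₂₂ - 1 with hK
  have hT : ∀ w w', (I.incidence * I.incidenceᵀ - 1 : Matrix _ _ ℝ) w w' =
      (if I.tgtIdx w = I.tgtIdx w' then 1 else 0) - if w = w' then 1 else 0 := by
    intro w w'
    rw [Matrix.sub_apply, Matrix.mul_apply, Matrix.one_apply]
    simp [Matrix.transpose_apply, incidence_apply, eq_comm]
  ext ⟨⟨α, i⟩, k⟩ ⟨⟨β, ⟨j, hj⟩⟩, l⟩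
  rw [Matrix.map_apply, Matrix.mul_apply]
  have hT0 : ∀ (γ : H.Factor) (j' : {i : V // i ∈ γ.1}) (k' : Fin (I.dimV j')),
      (I.incidence * I.incidenceᵀ - 1 : Matrix _ _ ℝ) ⟨⟨γ, j'⟩, k'⟩ ⟨⟨β, ⟨j, hj⟩⟩, l⟩ ≠ 0 →
      ∃ h : j ∈ γ.1, (⟨⟨γ, j'⟩, k'⟩ : Σ e : H.DirEdge, Fin (I.edgeDim e)) =
        ⟨⟨γ, ⟨j, h⟩⟩, l⟩ := by
    rintro γ ⟨j', hj'⟩ k' hne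
    rw [hT] at hne
    have h1 : (⟨j', k'⟩ : Σ i : V, Fin (I.dimV i)) = ⟨j, l⟩ := by
      by_contra hc
      apply hne
      have hc' : ¬ I.tgtIdx ⟨⟨γ, ⟨j', hj'⟩⟩, k'⟩ = I.tgtIdx ⟨⟨β, ⟨j, hj⟩⟩, l⟩ := hc
      rw [if_neg hc', if_neg, sub_zero]
      exact fun h => hc' (congrArg I.tgtIdx h)
    obtain ⟨rfl, h2⟩ := Sigma.mk.inj_iff.1 h1
    obtain rfl := eq_of_heq h2
    exact ⟨hj', rfl⟩
  change (I.weight η).block ⟨α, i⟩ ⟨β, ⟨j, hj⟩⟩ k l = _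
  by_cases hjα : j ∈ α.1
  -- The only possible intermediate edge is `α → j`, in the same component `l`.
  · rw [Finset.sum_eq_single (⟨⟨α, ⟨j, hjα⟩⟩, l⟩ : Σ e : H.DirEdge, Fin (I.edgeDim e))]
    · have hτ : I.tgtIdx ⟨⟨α, ⟨j, hjα⟩⟩, l⟩ = I.tgtIdx ⟨⟨β, ⟨j, hj⟩⟩, l⟩ := rfl
      rw [hT, if_pos hτ]
      by_cases hij : i = ⟨j, hjα⟩
      · subst hij
        rw [hK, edgeVar_inv_mul_sub_one_of_eq hη, zero_mul]
        have hf : ¬ H.Follows ⟨β, ⟨j, hj⟩⟩ ⟨α, ⟨j, hjα⟩⟩ := fun h => h.2.1 rfl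
        simp [FinHypergraph.Weight.block, hf]
      · rw [hK, edgeVar_inv_mul_sub_one_of_ne hη α hij]
        by_cases hαβ : β = α
        · subst hαβ
          have hf : ¬ H.Follows ⟨β, ⟨j, hj⟩⟩ ⟨β, i⟩ := fun h => h.2.2 rfl
          simp [FinHypergraph.Weight.block, hf]
        · have hf : H.Follows ⟨β, ⟨j, hj⟩⟩ ⟨α, i⟩ :=
            ⟨hjα, fun h => hij (Subtype.ext h.symm), hαβ⟩
          rw [if_neg, sub_zero, mul_one, FinHypergraph.Weight.block, dif_pos hf]
          · rfl
          · intro h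
            exact hαβ (congrArg (fun s : Σ e : H.DirEdge, Fin (I.edgeDim e) => s.1.1) h).symm
    · rintro ⟨⟨γ, j'⟩, k'⟩ - hne
      by_cases hγ : α = γ
      · subst hγ
        by_contra hc
        obtain ⟨h1, h2⟩ := hT0 _ _ _ (right_ne_zero_of_mul hc)
        exact hne h2
      · rw [hK, edgeVar_inv_mul_sub_one_of_src_ne hη hγ, zero_mul]
    · simp
  · have hf : ¬ H.Follows ⟨β, ⟨j, hj⟩⟩ ⟨α, i⟩ := fun h => hjα h.1
    rw [Finset.sum_eq_zero]
    · simp [FinHypergraph.Weight.block, hf]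
    · rintro ⟨⟨γ, j'⟩, k'⟩ -
      by_cases hγ : α = γ
      · subst hγ
        by_contra hc
        obtain ⟨h1, h2⟩ := hT0 _ _ _ (right_ne_zero_of_mul hc)
        exact hjα h1
      · rw [hK, edgeVar_inv_mul_sub_one_of_src_ne hη hγ, zero_mul]

end InferenceFamily

theorem Matrix.transpose_mul_submatrix_mul {m n κ R : Type*} [Fintype m] [Fintype n] [CommRing R]
    (N : Matrix n κ R) (D : Matrix m m R) (e : m ≃ n) :
    Nᵀ * D.submatrix e.symm e.symm * N =
      (N.submatrix e id)ᵀ * D * N.submatrix e id := by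
  have h : N = (N.submatrix e id).submatrix e.symm id := by
    ext a b
    simp
  conv_lhs => rw [h, transpose_submatrix, submatrix_mul_equiv, submatrix_mul_equiv,
    submatrix_id_id]

namespace InferenceFamily

variable {V : Type*} [DecidableEq V] {H : FinHypergraph V} {X : V → Type*}
  [∀ i, MeasurableSpace (X i)] {I : InferenceFamily H X} {η : I.Coord → ℝ}

/-! ### The Hessian of the Bethe free energy -/

variable (I)

/-- The coordinates that make up `η_α`. -/
def factorCoord (α : H.Factor) : I.FactorIdx α → I.Coord :=
  Sum.elim (fun k => .inl ⟨α, k⟩) fun k => .inr ⟨k.1, k.2⟩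

theorem factorPart_eq (η : I.Coord → ℝ) (α : H.Factor) :
    I.factorPart η α = η ∘ I.factorCoord α := by
  funext k
  rcases k with k | k <;> rfl

/-- The coordinates that make up `η_i`. -/
def vertexCoord (i : V) : Fin (I.dimV i) → I.Coord := fun k => .inr ⟨i, k⟩

theorem vertexPart_eq (η : I.Coord → ℝ) (i : V) :
    I.vertexPart η i = η ∘ I.vertexCoord i := rfl

variable {I}

theorem contDiffAt_legendre_factorPart [Fintype V] (hη : η ∈ I.localSet) (α : H.Factor) :
    ContDiffAt ℝ 2 (fun y => (I.factorFamily α).legendre (I.factorPart y α)) η := by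
  simp only [factorPart_eq]
  have h := (legendre_factor hη α).1
  rw [factorPart_eq] at h
  exact ContDiffAt.comp (g := (I.factorFamily α).legendre) η h
    (selectCLM (I.factorCoord α)).contDiff.contDiffAt

theorem contDiffAt_legendre_vertexPart [Fintype V] (hη : η ∈ I.localSet) (i : V) :
    ContDiffAt ℝ 2 (fun y => (I.vertexFamily i).legendre (I.vertexPart y i)) η :=
  ContDiffAt.comp (g := (I.vertexFamily i).legendre) η (legendre_vertex hη i).1
    (selectCLM (I.vertexCoord i)).contDiff.contDiffAt

theorem hessian_legendre_factorPart [Fintype V] (hη : η ∈ I.localSet) (α : H.Factor) :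
    hessian (fun y => (I.factorFamily α).legendre (I.factorPart y α)) η =
      ((1 : Matrix I.Coord I.Coord ℝ).submatrix (I.factorCoord α) id)ᵀ * (I.factorVar η α)⁻¹ *
        (1 : Matrix I.Coord I.Coord ℝ).submatrix (I.factorCoord α) id := by
  obtain ⟨h1, h2⟩ := legendre_factor hη α
  simp only [factorPart_eq] at h1 h2 ⊢
  rw [hessian_comp_select _ h1, h2]

theorem hessian_legendre_vertexPart [Fintype V] (hη : η ∈ I.localSet) (i : V) :
    hessian (fun y => (I.vertexFamily i).legendre (I.vertexPart y i)) η =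
      ((1 : Matrix I.Coord I.Coord ℝ).submatrix (I.vertexCoord i) id)ᵀ * (I.vertexVar η i)⁻¹ *
        (1 : Matrix I.Coord I.Coord ℝ).submatrix (I.vertexCoord i) id := by
  obtain ⟨h1, h2⟩ := legendre_vertex hη i
  simp only [vertexPart_eq] at h1 h2 ⊢
  rw [hessian_comp_select _ h1, h2]

/-- The linear part of the Bethe free energy. -/
noncomputable def betheLinear [Fintype V] (θbar : (α : H.Factor) → I.FactorIdx α → ℝ) :
    (I.Coord → ℝ) →L[ℝ] ℝ :=
  -∑ α : H.Factor, dotCLM _ (θbar α) ∘L selectCLM (I.factorCoord α)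

theorem betheFreeEnergy_eq [Fintype V] (θbar : (α : H.Factor) → I.FactorIdx α → ℝ) :
    I.betheFreeEnergy θbar = fun y =>
      (betheLinear θbar y + ∑ α : H.Factor, (I.factorFamily α).legendre (I.factorPart y α)) +
        ∑ i : V, (1 - (H.degree i : ℝ)) * (I.vertexFamily i).legendre (I.vertexPart y i) := by
  funext y
  rw [betheFreeEnergy]
  congr 2
  simp only [betheLinear, _root_.neg_apply, _root_.sum_apply, ContinuousLinearMap.comp_apply,
    dotCLM_apply, factorPart_eq]
  rfl

theorem contDiffAt_sum_legendre_factorPart [Fintype V] (hη : η ∈ I.localSet)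
    (θbar : (α : H.Factor) → I.FactorIdx α → ℝ) :
    ContDiffAt ℝ 2 (fun y => betheLinear θbar y +
      ∑ α : H.Factor, (I.factorFamily α).legendre (I.factorPart y α)) η :=
  (betheLinear θbar).contDiff.contDiffAt.add
    (ContDiffAt.sum fun α _ => contDiffAt_legendre_factorPart hη α)

theorem contDiffAt_betheFreeEnergy [Fintype V] (hη : η ∈ I.localSet)
    (θbar : (α : H.Factor) → I.FactorIdx α → ℝ) :
    ContDiffAt ℝ 2 (I.betheFreeEnergy θbar) η := by
  rw [betheFreeEnergy_eq]
  exact (contDiffAt_sum_legendre_factorPart hη θbar).add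
    (ContDiffAt.sum fun i _ => contDiffAt_const.mul (contDiffAt_legendre_vertexPart hη i))

theorem hessian_betheFreeEnergy_eq_sum [Fintype V] (hη : η ∈ I.localSet)
    (θbar : (α : H.Factor) → I.FactorIdx α → ℝ) :
    hessian (I.betheFreeEnergy θbar) η =
      ∑ α : H.Factor, ((1 : Matrix I.Coord I.Coord ℝ).submatrix (I.factorCoord α) id)ᵀ *
        (I.factorVar η α)⁻¹ * (1 : Matrix I.Coord I.Coord ℝ).submatrix (I.factorCoord α) id +
      ∑ i : V, ((1 : Matrix I.Coord I.Coord ℝ).submatrix (I.vertexCoord i) id)ᵀ *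
        ((1 - (H.degree i : ℝ)) • (I.vertexVar η i)⁻¹) *
          (1 : Matrix I.Coord I.Coord ℝ).submatrix (I.vertexCoord i) id := by
  have hv : ∀ i ∈ Finset.univ, ContDiffAt ℝ 2 (fun y => (1 - (H.degree i : ℝ)) *
      (I.vertexFamily i).legendre (I.vertexPart y i)) η :=
    fun i _ => contDiffAt_const.mul (contDiffAt_legendre_vertexPart hη i)
  have hf : ∀ α ∈ Finset.univ, ContDiffAt ℝ 2 (fun y =>
      (I.factorFamily α).legendre (I.factorPart y α)) η :=
    fun α _ => contDiffAt_legendre_factorPart hη α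
  rw [betheFreeEnergy_eq, hessian_add (contDiffAt_sum_legendre_factorPart hη θbar)
    (ContDiffAt.sum hv), hessian_add (betheLinear θbar).contDiff.contDiffAt (ContDiffAt.sum hf),
    hessian_continuousLinearMap, zero_add, hessian_sum _ hf, hessian_sum _ hv]
  congr 1
  · exact Finset.sum_congr rfl fun α _ => hessian_legendre_factorPart hη α
  · refine Finset.sum_congr rfl fun i _ => ?_
    rw [hessian_const_mul _ (contDiffAt_legendre_vertexPart hη i),
      hessian_legendre_vertexPart hη i, Matrix.mul_smul, Matrix.smul_mul]

variable (I) in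
/-- The incidence matrix of the components of the factor statistics and the coordinates. -/
noncomputable def fullIncidence :
    Matrix ((Σ α : H.Factor, Fin (I.dimF α)) ⊕ (Σ e : H.DirEdge, Fin (I.edgeDim e))) I.Coord ℝ :=
  fromBlocks 1 0 0 I.incidence

/-- The rows belonging to `α` select the coordinates of `η_α`, which lets the sum over factors be
written as a single congruence. -/
theorem submatrix_fullIncidence (α : H.Factor) :
    (I.fullIncidence.submatrix I.factorIdxEquiv id).submatrix (Sigma.mk α) id =
      (1 : Matrix I.Coord I.Coord ℝ).submatrix (I.factorCoord α) id := by
  ext (k | k) (c | c)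
  · change (1 : Matrix (Σ α : H.Factor, Fin (I.dimF α)) (Σ α : H.Factor, Fin (I.dimF α)) ℝ) _ _ =
      (1 : Matrix I.Coord I.Coord ℝ) (Sum.inl _) (Sum.inl _)
    simp [Matrix.one_apply]
  · rfl
  · rfl
  · change I.incidence _ _ = (1 : Matrix I.Coord I.Coord ℝ) (Sum.inr _) (Sum.inr _)
    rw [incidence_apply, Matrix.one_apply]
    refine if_congr ?_ rfl rfl
    exact Sum.inr_injective.eq_iff.symm

theorem sum_factor_eq (hη : η ∈ I.localSet) :
    ∑ α : H.Factor, ((1 : Matrix I.Coord I.Coord ℝ).submatrix (I.factorCoord α) id)ᵀ *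
        (I.factorVar η α)⁻¹ * (1 : Matrix I.Coord I.Coord ℝ).submatrix (I.factorCoord α) id =
      I.fullIncidenceᵀ * (I.allFactorVar η)⁻¹ * I.fullIncidence := by
  have h := transpose_mul_blockDiagonal'_mul (fun α => (I.factorVar η α)⁻¹)
    (I.fullIncidence.submatrix I.factorIdxEquiv id)
  simp only [submatrix_fullIncidence] at h
  rw [← h, allFactorVar, Matrix.inv_submatrix_equiv,
    inv_blockDiagonal' _ fun α => isUnit_det_factorVar hη α, transpose_mul_submatrix_mul]

theorem sum_vertex_eq [Fintype V] (hη : η ∈ I.localSet) :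
    ∑ i : V, ((1 : Matrix I.Coord I.Coord ℝ).submatrix (I.vertexCoord i) id)ᵀ *
        ((1 - (H.degree i : ℝ)) • (I.vertexVar η i)⁻¹) *
          (1 : Matrix I.Coord I.Coord ℝ).submatrix (I.vertexCoord i) id =
      fromBlocks 0 0 0 ((Matrix.diagonal fun u => 1 - (H.degree u.1 : ℝ)) *
        (blockDiagonal' (I.vertexVar η))⁻¹) := by
  have h := transpose_mul_blockDiagonal'_mul
    (fun i => (1 - (H.degree i : ℝ)) • (I.vertexVar η i)⁻¹)
    ((1 : Matrix I.Coord I.Coord ℝ).submatrix Sum.inr id)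
  refine Eq.trans h.symm ?_
  have hQ : (1 : Matrix I.Coord I.Coord ℝ).submatrix Sum.inr id =
      Matrix.fromCols (0 : Matrix (Σ i : V, Fin (I.dimV i)) (Σ α : H.Factor, Fin (I.dimF α)) ℝ)
        (1 : Matrix (Σ i : V, Fin (I.dimV i)) (Σ i : V, Fin (I.dimV i)) ℝ) := by
    ext a (b | b)
    · rfl
    · change (1 : Matrix I.Coord I.Coord ℝ) (Sum.inr a) (Sum.inr b) =
        (1 : Matrix (Σ i : V, Fin (I.dimV i)) (Σ i : V, Fin (I.dimV i)) ℝ) a b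
      simp [Matrix.one_apply]
  have hD : (blockDiagonal' fun i => (1 - (H.degree i : ℝ)) • (I.vertexVar η i)⁻¹) =
      (Matrix.diagonal fun u => 1 - (H.degree u.1 : ℝ)) * (blockDiagonal' (I.vertexVar η))⁻¹ := by
    rw [inv_blockDiagonal' _ fun i => isUnit_det_vertexVar hη i]
    ext ⟨i, k⟩ ⟨j, l⟩
    rw [Matrix.diagonal_mul]
    by_cases hij : i = j
    · subst hij
      rw [blockDiagonal'_apply_eq, blockDiagonal'_apply_eq]
      rfl
    · rw [blockDiagonal'_apply_ne _ _ _ hij, blockDiagonal'_apply_ne _ _ _ hij, mul_zero]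
  rw [hQ, hD, Matrix.transpose_fromCols, Matrix.fromRows_mul, Matrix.fromRows_mul_fromCols]
  simp

/-! ### The determinant of the Hessian in terms of `I - M(u)`. -/

theorem det_edgeVar [Fintype V] (η : I.Coord → ℝ) :
    (I.edgeVar η).det = ∏ i : V, (I.vertexVar η i).det ^ H.degree i := by
  rw [edgeVar, det_blockDiagonal',
    ← Finset.prod_fiberwise' Finset.univ (fun e : H.DirEdge => FinHypergraph.tgt e)
      (fun i => (I.vertexVar η i).det)]
  refine Finset.prod_congr rfl fun i _ => ?_
  rw [Finset.prod_const, card_tgt_eq]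

theorem det_hessian_betheFreeEnergy [Fintype V] (hη : η ∈ I.localSet)
    (θbar : (α : H.Factor) → I.FactorIdx α → ℝ) :
    (hessian (I.betheFreeEnergy θbar) η).det * (∏ i : V, (I.vertexVar η i).det) *
        (∏ α : H.Factor, (I.factorVar η α).det) =
      (∏ i : V, (I.vertexVar η i).det ^ H.degree i) *
        (1 - ((I.edgeVar η)⁻¹ * (I.allFactorVar η).toBlocks₂₂ - 1) *
          (I.incidence * I.incidenceᵀ - 1)).det := by
  have hA : (I.allFactorVar η).det = ∏ α : H.Factor, (I.factorVar η α).det := by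
    rw [allFactorVar, Matrix.det_submatrix_equiv_self, det_blockDiagonal']
  rw [hessian_betheFreeEnergy_eq_sum hη, sum_factor_eq hη, sum_vertex_eq hη, ← hA,
    ← det_blockDiagonal', ← det_edgeVar]
  refine det_transpose_mul_inv_mul_add _ _ _ _ _ ?_ ?_ ?_ (I.incidence_mul_blockDiagonal' η) ?_
  · rw [hA]
    exact isUnit_iff_ne_zero.2
      (Finset.prod_ne_zero_iff.2 fun α _ => (isUnit_det_factorVar hη α).ne_zero)
  · rw [edgeVar, det_blockDiagonal']
    exact isUnit_iff_ne_zero.2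
      (Finset.prod_ne_zero_iff.2 fun e _ => (isUnit_det_vertexVar hη _).ne_zero)
  · rw [det_blockDiagonal']
    exact isUnit_iff_ne_zero.2
      (Finset.prod_ne_zero_iff.2 fun i _ => (isUnit_det_vertexVar hη i).ne_zero)
  -- The coefficients `1 - d_i` of the Bethe free energy enter here: they are the diagonal entries
  -- of `1 - NᵀN`.
  · rw [transpose_incidence_mul, Matrix.diagonal_add, ← Matrix.diagonal_one]
    congr 1
    funext u
    ring

theorem det_one_sub_edgeMatrix_weight [Fintype V] (hη : η ∈ I.localSet)
    (θbar : (α : H.Factor) → I.FactorIdx α → ℝ) :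
    (1 - (I.weight η).edgeMatrix).det =
      (((hessian (I.betheFreeEnergy θbar) η).det *
        (∏ α : H.Factor, (I.factorVar η α).det) *
        ∏ i : V, (I.vertexVar η i).det ^ (1 - (H.degree i : ℤ)) : ℝ) : ℂ) := by
  set M := ((I.edgeVar η)⁻¹ * (I.allFactorVar η).toBlocks₂₂ - 1) *
    (I.incidence * I.incidenceᵀ - 1) with hM
  have h1 : (1 - (I.weight η).edgeMatrix).det = (((1 - M).det : ℝ) : ℂ) := by
    rw [edgeMatrix_weight hη, ← hM]
    have h2 : (1 - M.map Complex.ofReal) = Complex.ofRealHom.mapMatrix (1 - M) := by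
      rw [map_sub, map_one]
      rfl
    rw [h2, ← RingHom.map_det]
    rfl
  rw [h1]
  congr 1
  have h3 := det_hessian_betheFreeEnergy hη θbar
  rw [← hM] at h3
  have hne : ∀ i : V, (I.vertexVar η i).det ≠ 0 := fun i => (isUnit_det_vertexVar hη i).ne_zero
  -- The exponent may be negative, so it is split into one factor from `D_U` and the `d_i` factors
  -- from `D_W`.
  have h4 : ∏ i : V, (I.vertexVar η i).det ^ (1 - (H.degree i : ℤ)) =
      (∏ i : V, (I.vertexVar η i).det) / ∏ i : V, (I.vertexVar η i).det ^ H.degree i := by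
    rw [← Finset.prod_div_distrib]
    refine Finset.prod_congr rfl fun i _ => ?_
    rw [zpow_sub₀ (hne i), zpow_one, zpow_natCast]
  have h5 : ∏ i : V, (I.vertexVar η i).det ^ H.degree i ≠ 0 :=
    Finset.prod_ne_zero_iff.2 fun i _ => pow_ne_zero _ (hne i)
  rw [h4, ← mul_div_assoc, eq_div_iff h5, mul_comm (1 - M).det, ← h3]
  ring

end InferenceFamily

theorem theorem4 {V : Type*} [Fintype V] [DecidableEq V] (H : FinHypergraph V)
    (X : V → Type*) [∀ i, MeasurableSpace (X i)] (I : InferenceFamily H X)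
    (θbar : (α : H.Factor) → I.FactorIdx α → ℝ) :
    (∃! Z : H.Weight I.edgeDim → ℂ, H.IsReciprocalZeta I.edgeDim Z) ∧
    ∀ Z : H.Weight I.edgeDim → ℂ, H.IsReciprocalZeta I.edgeDim Z →
      ∀ η ∈ I.localSet,
        ContDiffAt ℝ 2 (I.betheFreeEnergy θbar) η ∧
        Z (I.weight η) = (1 - (I.weight η).edgeMatrix).det ∧
        (1 - (I.weight η).edgeMatrix).det =
          (((hessian (I.betheFreeEnergy θbar) η).det *
            (∏ α : H.Factor, (I.factorVar η α).det) *
            ∏ i : V, (I.vertexVar η i).det ^ (1 - (H.degree i : ℤ)) : ℝ) : ℂ) := by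
  refine ⟨⟨_, FinHypergraph.isReciprocalZeta_det H I.edgeDim, fun Z hZ => hZ.eq_det⟩, ?_⟩
  intro Z hZ η hη
  exact ⟨InferenceFamily.contDiffAt_betheFreeEnergy hη θbar, congrFun hZ.eq_det _,
    InferenceFamily.det_one_sub_edgeMatrix_weight hη θbar⟩
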